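/- Let $n\ge 1$. A set partition $\pi$ of $\{1,\dots,n\}$ is noncrossing if there are no $i<j<k<l$ with $i,k\in B_1$ and $j,l\in B_2$ for two distinct blocks $B_1,B_2$ of $\pi$. Let $\,^2\Pi_n$ be the set of noncrossing 2-partitions of $\{1,\dots,n\}$, i.e. of triples $(\pi,\rho,\lambda)$ where $\pi$ is a noncrossing partition of $\{1,\dots,n\}$, $\rho$ is a set partition of $\{1,\dots,n\}$, and $\lambda$ is a bijection from the blocks of $\pi$ to the blocks of $\rho$ with $|\lambda(B)|=|B|$ for every block $B$ of $\pi$. It is partially ordered by: $(\pi',\rho',\lambda')\le(\pi,\rho,\lambda)$ if and only if $\pi$ is a refinement of $\pi'$, $\rho$ is a refinement of $\rho'$, and whenever a block $B'$ of $\pi'$ is the disjoint union of blocks $B_1,\dots,B_j$ of $\pi$, then $\lambda'(B')$ is the disjoint union of $\lambda(B_1),\dots,\lambda(B_j)$. The rank $\mathrm{rk}(\phi)$ of $\phi\in\,^2\Pi_n$ is the maximal $r$ for which there is a strict chain $\psi_0<\psi_1<\dots<\psi_r=\phi$. Then for all integers $k\ge 1$ and $\ell\ge 0$, the number of multichains $\phi_1\le\dots\le\phi_k$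 in $\,^2\Pi_n$ with $\mathrm{rk}(\phi_k)=\ell$ is $$\ell!\,\binom{kn}{\ell}\,S_2(n,\ell+1),$$ where $S_2(n,m)$ is the Stirling number of the second kind, the number of partitions of an $n$-element set into $m$ nonempty blocks. -/

import Mathlib

/-- A set partition of `{1, …, n}` (modelled by the linearly ordered set `Fin n`) is noncrossing if
there are no `i < j < k < l` with `i, k` in one block and `j, l` in another block. -/
def IsNoncrossing {n : ℕ} (P : Finpartition (Finset.univ : Finset (Fin n))) : Prop :=
  ∀ B₁ ∈ P.parts, ∀ B₂ ∈ P.parts, B₁ ≠ B₂ →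
    ¬ ∃ i j k l : Fin n, i < j ∧ j < k ∧ k < l ∧ i ∈ B₁ ∧ k ∈ B₁ ∧ j ∈ B₂ ∧ l ∈ B₂

/-- Noncrossing 2-partitions: triples `(π, ρ, lam)` where `π` is a noncrossing partition, `ρ` is a
set partition, and `lam` is a cardinality-preserving bijection from the blocks of `π` to the
blocks of `ρ`. -/
structure NoncrossingTwoPartition (n : ℕ) where
  π : Finpartition (Finset.univ : Finset (Fin n))
  ρ : Finpartition (Finset.univ : Finset (Fin n))
  noncrossing : IsNoncrossing π
  lam : {B // B ∈ π.parts} ≃ {B // B ∈ ρ.parts}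
  card_lam : ∀ B : {B // B ∈ π.parts}, (lam B).1.card = B.1.card

namespace NoncrossingTwoPartition

variable {n : ℕ}

/-- `ψ ≤ φ` iff `φ.π` refines `ψ.π`, `φ.ρ` refines `ψ.ρ`, and whenever a block `B'` of `ψ.π` is the
union of a family `S` of blocks of `φ.π`, the block `ψ.lam B'` is the union of the blocks
`φ.lam B`, `B ∈ S`. (In Mathlib `P ≤ Q` means that `P` refines `Q`.) -/
instance : LE (NoncrossingTwoPartition n) where
  le ψ φ := φ.π ≤ ψ.π ∧ φ.ρ ≤ ψ.ρ ∧
    ∀ (S : Finset {B // B ∈ φ.π.parts}) (B' : {B // B ∈ ψ.π.parts}),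
      S.biUnion (fun B => B.1) = B'.1 → S.biUnion (fun B => (φ.lam B).1) = (ψ.lam B').1

theorem le_def (ψ φ : NoncrossingTwoPartition n) : ψ ≤ φ ↔ φ.π ≤ ψ.π ∧ φ.ρ ≤ ψ.ρ ∧
    ∀ (S : Finset {B // B ∈ φ.π.parts}) (B' : {B // B ∈ ψ.π.parts}),
      S.biUnion (fun B => B.1) = B'.1 → S.biUnion (fun B => (φ.lam B).1) = (ψ.lam B').1 :=
  Iff.rfl

theorem eq_of_subset_parts {P : Finpartition (Finset.univ : Finset (Fin n))}
    {A B : Finset (Fin n)} (hA : A ∈ P.parts) (hB : B ∈ P.parts) (h : A ⊆ B) : A = B := by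
  obtain ⟨a, ha⟩ := P.nonempty_of_mem_parts hA
  exact P.eq_of_mem_parts hA hB ha (h ha)

/-- A convenient form of the order relation. -/
theorem le_iff (ψ φ : NoncrossingTwoPartition n) : ψ ≤ φ ↔ φ.π ≤ ψ.π ∧
    ∀ (B : {B // B ∈ φ.π.parts}) (B' : {B // B ∈ ψ.π.parts}),
      B.1 ⊆ B'.1 → (φ.lam B).1 ⊆ (ψ.lam B').1 := by
  constructor
  · rintro ⟨h₁, -, h₃⟩
    refine ⟨h₁, fun B B' hB => ?_⟩
    have key := h₃ (Finset.univ.filter fun C => C.1 ⊆ B'.1) B' (by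
      ext x
      simp only [Finset.mem_biUnion, Finset.mem_filter, Finset.mem_univ, true_and]
      constructor
      · rintro ⟨C, hC, hx⟩
        exact hC hx
      · intro hx
        obtain ⟨C, hC, hxC⟩ := φ.π.exists_mem (Finset.mem_univ x)
        obtain ⟨D, hD, hCD⟩ := h₁ hC
        have hDB : D = B'.1 := ψ.π.eq_of_mem_parts hD B'.2 (hCD hxC) hx
        exact ⟨⟨C, hC⟩, hDB ▸ hCD, hxC⟩)
    rw [← key]
    exact Finset.subset_biUnion_of_mem (fun B => (φ.lam B).1) (by simpa using hB)
  · rintro ⟨h₁, h₂⟩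
    refine ⟨h₁, ?_, ?_⟩
    · intro C hC
      obtain ⟨D, hD, hCD⟩ := h₁ (φ.lam.symm ⟨C, hC⟩).2
      exact ⟨_, (ψ.lam ⟨D, hD⟩).2, by simpa using h₂ (φ.lam.symm ⟨C, hC⟩) ⟨D, hD⟩ hCD⟩
    · intro S B' hS
      apply Finset.eq_of_subset_of_card_le
      · apply Finset.biUnion_subset.2
        intro B hB
        exact h₂ B B' (hS ▸ Finset.subset_biUnion_of_mem (fun B => B.1) hB)
      · rw [ψ.card_lam, ← hS, Finset.card_biUnion, Finset.card_biUnion]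
        · exact le_of_eq (Finset.sum_congr rfl fun B _ => (φ.card_lam B).symm)
        · intro A _ B _ hAB
          exact φ.ρ.disjoint (φ.lam A).2 (φ.lam B).2
            fun h => hAB (φ.lam.injective (Subtype.ext h))
        · intro A _ B _ hAB
          exact φ.π.disjoint A.2 B.2 fun h => hAB (Subtype.ext h)

instance : PartialOrder (NoncrossingTwoPartition n) where
  le_refl φ := by
    rw [le_iff]
    refine ⟨le_rfl, fun B B' h => ?_⟩
    have : B = B' := Subtype.ext (eq_of_subset_parts B.2 B'.2 h)
    rw [this]
  le_trans a b c hab hbc := by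
    rw [le_iff] at *
    refine ⟨hbc.1.trans hab.1, fun B B' h => ?_⟩
    obtain ⟨D, hD, hBD⟩ := hbc.1 B.2
    obtain ⟨E, hE, hDE⟩ := hab.1 hD
    obtain ⟨x, hx⟩ := c.π.nonempty_of_mem_parts B.2
    have hEB : E = B'.1 := a.π.eq_of_mem_parts hE B'.2 (hDE (hBD hx)) (h hx)
    exact (hbc.2 B ⟨D, hD⟩ hBD).trans (hab.2 ⟨D, hD⟩ B' (hEB ▸ hDE))
  le_antisymm a b hab hba := by
    have hπ : a.π = b.π := le_antisymm hba.1 hab.1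
    have hρ : a.ρ = b.ρ := le_antisymm hba.2.1 hab.2.1
    rw [le_iff] at hab hba
    obtain ⟨π, ρ, h, l, hl⟩ := a
    obtain ⟨π', ρ', h', l', hl'⟩ := b
    simp only at hπ hρ
    subst hπ hρ
    have : l = l' := by
      ext1 B
      exact Subtype.ext ((hba.2 B B subset_rfl).antisymm (hab.2 B B subset_rfl))
    subst this
    rfl

instance : Finite (NoncrossingTwoPartition n) := by
  let f : NoncrossingTwoPartition n →
      Σ P : Finpartition (Finset.univ : Finset (Fin n)) ×
        Finpartition (Finset.univ : Finset (Fin n)),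
        {B // B ∈ P.1.parts} ≃ {B // B ∈ P.2.parts} := fun φ => ⟨(φ.π, φ.ρ), φ.lam⟩
  refine Finite.of_injective f ?_
  rintro ⟨π, ρ, h, l, hl⟩ ⟨π', ρ', h', l', hl'⟩ hf
  simp only [f, Sigma.mk.injEq, Prod.mk.injEq] at hf
  obtain ⟨⟨rfl, rfl⟩, hf⟩ := hf
  cases hf
  rfl

end NoncrossingTwoPartition

/-! A pair (ρ, λ) over a fixed π is a way of writing λ as B ↦ σ(B) with σ a permutation, where σ
matters only up to permutations preserving every block of π (`exists_eq_ofPerm`,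
`ofPerm_eq_ofPerm_iff`). Hence n!/∏|B|! elements lie over π (`card_mul_prod_factorial`). Anything
below the element given by σ is given by the same σ (`eq_ofPerm_of_le`), so a multichain is a chain
of noncrossing partitions π₁ ≥ ⋯ ≥ π_k in the refinement order together with one element over the
finest, π_k. The rank is the number of blocks minus one (`height_eq`), because two blocks containing
adjacent integers can be merged without creating a crossing.

It remains to sum n!/∏|B|! over such chains with ℓ + 1 blocks in π_k. Give a block of size s the
weight t/s!, so that the exponent of t counts blocks, and put W = 1 + t(eˣ − 1). Splitting off the
block of the smallest element shows that summing over noncrossing partitions turns a weight series W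
into the solution of M = W(xM) (`ncSeries_eq_subst`). Summing over chains of length k iterates this
k times, which amounts to M = W(xMᵏ) (`eq_subst_of_forall_eq_subst`, `sum_antitone_chains`).

Lagrange inversion (`coeff_of_eq_subst`) gives (kn + 1)[xⁿ]M = [xⁿ]W^(kn+1). The coefficient of
t^(ℓ+1) on the right is C(kn+1, ℓ+1)(ℓ+1)! S₂(n, ℓ+1)/n!, and C(kn+1, ℓ+1)(ℓ+1) = (kn+1)C(kn, ℓ)
finishes the count. -/

/-! ### Power series: Stirling numbers, iterated substitution, Lagrange inversion. -/

section PowerSeriesLemmas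

open PowerSeries

/-- The exponential generating function of the Stirling numbers of the second kind. -/
theorem coeff_exp_sub_one_pow (n j : ℕ) :
    (coeff n ((exp ℚ - 1) ^ j) : ℚ) = (j.factorial * n.stirlingSecond j : ℕ) / n.factorial := by
  induction n generalizing j with
  | zero =>
    cases j with
    | zero => simp
    | succ j => simp
  | succ n ih =>
    cases j with
    | zero => simp [coeff_one]
    | succ j =>
      -- Since (eˣ − 1)' = (eˣ − 1) + 1, differentiation reproduces the Stirling recurrence on
      -- coefficients.
      have h : d⁄dX ℚ ((exp ℚ - 1) ^ (j + 1)) =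
          C ((j : ℚ) + 1) * ((exp ℚ - 1) ^ (j + 1) + (exp ℚ - 1) ^ j) := by
        rw [derivative_pow, map_sub, derivative_exp, derivative_one]
        simp only [Nat.add_sub_cancel, map_add, map_natCast, map_one, Nat.cast_add, Nat.cast_one]
        ring
      have h2 := congrArg (coeff n) h
      rw [coeff_derivative, coeff_C_mul, map_add, ih, ih] at h2
      have hn : ((n : ℚ) + 1) ≠ 0 := by positivity
      have hf : (n.factorial : ℚ) ≠ 0 := by positivity
      rw [eq_div_iff (by positivity), Nat.factorial_succ n, Nat.stirlingSecond_succ_succ]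
      rw [← add_div, mul_div_assoc', eq_div_iff hf] at h2
      push_cast [Nat.factorial_succ] at h2 ⊢
      linear_combination h2

variable {R : Type*} [CommRing R]

theorem coeff_mul_X_mul_derivative (F : R⟦X⟧) (q : ℕ) :
    coeff q (X * d⁄dX R F) = q * coeff q F := by
  cases q with
  | zero => simp
  | succ q => rw [coeff_succ_X_mul, coeff_derivative]; push_cast; ring

/-- The coefficient of a composite, as a finite sum. -/
theorem coeff_subst_eq_sum {u : R⟦X⟧} (hu : constantCoeff u = 0) (F : R⟦X⟧) {j n : ℕ}
    (hj : j ≤ n) :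
    coeff j (F.subst u) = ∑ p ∈ Finset.range (n + 1), coeff p F * coeff j (u ^ p) := by
  rw [coeff_subst' (HasSubst.of_constantCoeff_zero' hu)]
  rw [finsum_eq_sum_of_support_subset]
  · rfl
  · intro p hp
    by_contra hpn
    apply hp
    have : coeff j (u ^ p) = 0 := by
      obtain ⟨v, rfl⟩ := X_dvd_iff.2 hu
      rw [mul_pow, coeff_X_pow_mul', if_neg]
      simp at hpn
      omega
    simp [this]

theorem coeff_subst_mul_eq_sum {u : R⟦X⟧} (hu : constantCoeff u = 0) (F K : R⟦X⟧) (n : ℕ) :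
    coeff n (F.subst u * K) = ∑ p ∈ Finset.range (n + 1), coeff p F * coeff n (u ^ p * K) := by
  simp only [coeff_mul, Finset.mul_sum]
  rw [Finset.sum_comm]
  refine Finset.sum_congr rfl fun x hx => ?_
  rw [coeff_subst_eq_sum hu F (n := n) (by have := Finset.HasAntidiagonal.mem_antidiagonal.1 hx; omega),
    Finset.sum_mul]
  exact Finset.sum_congr rfl fun p _ => by ring

/-- Iterating the substitution `M (j + 1) = M j (X M (j + 1))`. -/
theorem eq_subst_of_forall_eq_subst {M : ℕ → R⟦X⟧}
    (h : ∀ j, M (j + 1) = (M j).subst (X * M (j + 1))) (j : ℕ) :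
    M j = (M 0).subst (X * M j ^ j) := by
  induction j with
  | zero => rw [pow_zero, mul_one]; exact (X_subst _).symm
  | succ j ih =>
    have hu (i : ℕ) : HasSubst (X * M i ^ i) := HasSubst.of_constantCoeff_zero' (by simp)
    have hu' : HasSubst (X * M (j + 1)) := HasSubst.of_constantCoeff_zero' (by simp)
    -- Substituting X M_{j+1} turns the inner M_j into M_{j+1}, while the leading X contributes the
    -- extra factor that raises the exponent to j + 1.
    have h1 : M (j + 1) = (M 0).subst ((X * M j ^ j).subst (X * M (j + 1))) := by
      rw [← subst_comp_subst_apply (hu j) hu', ← ih, ← h]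
    rw [subst_mul hu', subst_X hu', subst_pow hu', ← h, mul_assoc, ← pow_succ'] at h1
    exact h1

/-- Binomial expansion of `(1 + t (exp z - 1)) ^ m`. -/
theorem coeff_coeff_one_add_C_X_mul_exp_sub_one_pow (n m j : ℕ) :
    (coeff n ((1 + C Polynomial.X * (exp (Polynomial ℚ) - 1)) ^ m)).coeff j =
      ((m.choose j * (j.factorial * n.stirlingSecond j) : ℕ) : ℚ) / n.factorial := by
  have h (i : ℕ) : coeff n ((exp (Polynomial ℚ) - 1) ^ i) =
      Polynomial.C (((i.factorial * n.stirlingSecond i : ℕ) : ℚ) / n.factorial) := by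
    rw [← coeff_exp_sub_one_pow, ← map_exp (algebraMap ℚ (Polynomial ℚ)),
      ← map_one (PowerSeries.map (algebraMap ℚ (Polynomial ℚ))), ← map_sub, ← map_pow, coeff_map]
    rfl
  have h' (i : ℕ) : (C Polynomial.X * (exp (Polynomial ℚ) - 1)) ^ i * 1 ^ (m - i) *
      ((m.choose i : ℕ) : (Polynomial ℚ)⟦X⟧) =
      C ((m.choose i : Polynomial ℚ) * Polynomial.X ^ i) * (exp (Polynomial ℚ) - 1) ^ i := by
    rw [map_mul, map_pow, map_natCast, mul_pow]; ring
  rw [add_comm, add_pow, map_sum, Polynomial.finsetSum_coeff]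
  simp only [h', coeff_C_mul, h]
  have h2 (i : ℕ) : ((m.choose i : Polynomial ℚ) * Polynomial.X ^ i *
      Polynomial.C (((i.factorial * n.stirlingSecond i : ℕ) : ℚ) / n.factorial)).coeff j =
      if j = i then ((m.choose j * (j.factorial * n.stirlingSecond j) : ℕ) : ℚ) / (n.factorial : ℚ)
        else 0 := by
    rw [Polynomial.coeff_mul_C, ← Polynomial.C_eq_natCast, Polynomial.coeff_C_mul_X_pow]
    split_ifs with hij
    · subst hij; push_cast; ring
    · simp
  simp only [h2, Finset.sum_ite_eq, Finset.mem_range]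
  split_ifs with hjm
  · rfl
  · rw [Nat.choose_eq_zero_of_lt (by omega)]; simp

variable [IsDomain R] [CharZero R]

/-- A residue-free form of Lagrange duality: the second factor extracts the n-th coefficient in
powers of XΨ. For p < n and r = n − p, what remains is Φʳ − X(Φʳ)'/r, whose r-th coefficient
vanishes. -/
theorem coeff_lagrange_kernel {Φ Ψ : R⟦X⟧} (h : Ψ * Φ = 1) {n p : ℕ}
    (hn : n ≠ 0) (hp : p ≤ n) :
    coeff n ((X * Ψ) ^ p * (Φ ^ n - X * (Φ ^ (n - 1) * d⁄dX R Φ))) = if p = n then 1 else 0 := by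
  obtain ⟨q, rfl⟩ := Nat.exists_eq_add_of_le hp
  have hΨΦ : Ψ ^ p * Φ ^ p = 1 := by rw [← mul_pow, h, one_pow]
  rw [mul_pow, mul_assoc, coeff_X_pow_mul', if_pos hp, Nat.add_sub_cancel_left]
  cases q with
  | zero =>
    rw [Nat.add_zero, mul_sub, hΨΦ]
    simp
  | succ q =>
    have e : Ψ ^ p * (Φ ^ (p + (q + 1)) - X * (Φ ^ (p + (q + 1) - 1) * d⁄dX R Φ)) =
        Φ ^ (q + 1) - X * (Φ ^ q * d⁄dX R Φ) := by
      have : p + (q + 1) - 1 = p + q := by omega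
      rw [this, pow_add, pow_add]
      linear_combination (Φ ^ (q + 1) - X * (Φ ^ q * d⁄dX R Φ)) * hΨΦ
    rw [e, if_neg (by omega)]
    have h2 := coeff_mul_X_mul_derivative (Φ ^ (q + 1)) (q + 1)
    rw [derivative_pow, Nat.add_sub_cancel] at h2
    have h3 : X * (((q + 1 : ℕ) : R⟦X⟧) * Φ ^ q * d⁄dX R Φ) =
        C ((q + 1 : ℕ) : R) * (X * (Φ ^ q * d⁄dX R Φ)) := by
      rw [map_natCast]; ring
    rw [h3, coeff_C_mul] at h2
    rw [map_sub, sub_eq_zero]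
    exact (mul_left_cancel₀ (Nat.cast_ne_zero.2 q.succ_ne_zero) h2).symm

/-- Lagrange inversion for the equation `M = C(X M ^ k)`. -/
theorem coeff_of_eq_subst {c M : R⟦X⟧} (hc : constantCoeff c = 1) (k : ℕ)
    (hM : M = c.subst (X * M ^ k)) (n : ℕ) :
    (k * n + 1 : ℕ) * coeff n M = coeff n (c ^ (k * n + 1)) := by
  have hu0 : constantCoeff (X * M ^ k) = 0 := by simp
  have hu : HasSubst (X * M ^ k) := HasSubst.of_constantCoeff_zero' hu0
  have hM0 : constantCoeff M = 1 := by
    rw [← coeff_zero_eq_constantCoeff_apply, hM, coeff_subst_eq_sum hu0 c le_rfl]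
    simp [hc]
  rcases Nat.eq_zero_or_pos n with rfl | hn
  · simp [hM0, hc]
  have hΦ0 : constantCoeff (c ^ k) = 1 := by simp [hc]
  set Ψ := invOfUnit (c ^ k) 1 with hΨ
  have hΨΦ : Ψ * c ^ k = 1 := invOfUnit_mul _ _ (by simpa using hΦ0)
  have hh0 : constantCoeff (X * Ψ) = 0 := by simp
  have hh : HasSubst (X * Ψ) := HasSubst.of_constantCoeff_zero' hh0
  have hh1 : IsUnit (coeff 1 (X * Ψ)) := by
    rw [show (1 : ℕ) = 0 + 1 from rfl, coeff_succ_X_mul]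
    simp [hΨ]
  have hMu : IsUnit (M ^ k) := by
    apply IsUnit.pow
    rw [isUnit_iff_constantCoeff, hM0]
    exact isUnit_one
  -- The series X Mᵏ and X c⁻ᵏ are compositional inverses, so substituting the latter into M gives
  -- c.
  have h1 : (X * Ψ).subst (X * M ^ k) = X := by
    apply hMu.mul_right_cancel
    have : M ^ k = (c ^ k).subst (X * M ^ k) := by rw [subst_pow hu, ← hM]
    calc (X * Ψ).subst (X * M ^ k) * M ^ k
        = (X * Ψ).subst (X * M ^ k) * (c ^ k).subst (X * M ^ k) := by rw [← this]
      _ = (X * (Ψ * c ^ k)).subst (X * M ^ k) := by rw [← subst_mul hu, mul_assoc]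
      _ = X * M ^ k := by rw [hΨΦ, mul_one, subst_X hu]
  have h2 : X * M ^ k = (X * Ψ).substInvOfIsUnit hh1 := by
    have := subst_comp_subst_apply hh hu ((X * Ψ).substInvOfIsUnit hh1)
    rw [subst_substInvOfIsUnit_left _ hh0, h1, subst_X hu] at this
    rw [this]
    exact X_subst _
  have h3 : (X * M ^ k).subst (X * Ψ) = X := by
    rw [h2, subst_substInvOfIsUnit_left _ hh0]
  have h4 : M.subst (X * Ψ) = c := by
    have := subst_comp_subst_apply hu hh c
    rw [← hM, h3] at this
    rw [this]
    exact X_subst _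
  have h5 := coeff_subst_mul_eq_sum hh0 M
    ((c ^ k) ^ n - X * ((c ^ k) ^ (n - 1) * d⁄dX R (c ^ k))) n
  rw [Finset.sum_congr rfl fun p hp => by
    rw [coeff_lagrange_kernel hΨΦ hn.ne' (Nat.lt_succ_iff.1 (Finset.mem_range.1 hp))]] at h5
  rw [h4] at h5
  simp only [mul_ite, mul_one, mul_zero, Finset.sum_ite_eq', Finset.mem_range, Nat.lt_succ_self,
    if_true] at h5
  have h6 := coeff_mul_X_mul_derivative (c ^ (k * n + 1)) n
  -- On n-th coefficients X d/dX multiplies by n, so the right side contributes (kn + 1) − kn = 1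
  -- times the coefficient of c^(kn+1).
  have h7 : C ((k * n + 1 : ℕ) : R) * (c * ((c ^ k) ^ n - X * ((c ^ k) ^ (n - 1) * d⁄dX R (c ^ k))))
      = C ((k * n + 1 : ℕ) : R) * c ^ (k * n + 1) - C ((k : ℕ) : R) * (X * d⁄dX R (c ^ (k * n + 1))) := by
    simp only [derivative_pow, map_natCast]
    rcases Nat.eq_zero_or_pos k with rfl | hk
    · simp
    obtain ⟨n, rfl⟩ := Nat.exists_eq_succ_of_ne_zero hn.ne'
    obtain ⟨k, rfl⟩ := Nat.exists_eq_succ_of_ne_zero hk.ne'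
    have e1 : (c ^ (k + 1)) ^ n * c ^ k = c ^ ((k + 1) * n + k) := by rw [← pow_mul, ← pow_add]
    simp only [Nat.succ_eq_add_one, Nat.add_sub_cancel, ← pow_mul]
    push_cast
    ring
  have h8 := congrArg (coeff n) h7
  rw [coeff_C_mul, map_sub, coeff_C_mul, coeff_C_mul, h6, h5] at h8
  rw [h8]
  push_cast
  ring

end PowerSeriesLemmas

/-! ### Noncrossing families of blocks and the gaps of a block. -/

section NoncrossingFamilies

open Finset

variable {α : Type} [LinearOrder α]

/-- There are no `i < j < k < l` with `i, k ∈ A` and `j, l ∈ B`. -/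
def Uncrossed (A B : Finset α) : Prop :=
  ∀ i ∈ A, ∀ j ∈ B, ∀ k ∈ A, ∀ l ∈ B, i < j → j < k → ¬ k < l

theorem Uncrossed.mono {A B A' B' : Finset α} (h : Uncrossed A B) (hA : A' ⊆ A) (hB : B' ⊆ B) :
    Uncrossed A' B' :=
  fun i hi j hj k hk l hl => h i (hA hi) j (hB hj) k (hA hk) l (hB hl)

/-- `F` is the set of blocks of a noncrossing partition of `S`. -/
structure IsNoncrossingFamily (S : Finset α) (F : Finset (Finset α)) : Prop where
  nonempty : ∀ B ∈ F, B.Nonempty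
  eq_of_mem : ∀ A ∈ F, ∀ B ∈ F, ∀ x, x ∈ A → x ∈ B → A = B
  mem_iff : ∀ x, x ∈ S ↔ ∃ B ∈ F, x ∈ B
  uncrossed : ∀ A ∈ F, ∀ B ∈ F, A ≠ B → Uncrossed A B

theorem IsNoncrossingFamily.subset {S : Finset α} {F : Finset (Finset α)}
    (h : IsNoncrossingFamily S F) {B : Finset α} (hB : B ∈ F) : B ⊆ S :=
  fun x hx => (h.mem_iff x).2 ⟨B, hB, hx⟩

open Classical in
/-- The noncrossing partitions of a finite subset of a linear order, as sets of blocks. -/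
noncomputable def ncFamilies (S : Finset α) : Finset (Finset (Finset α)) :=
  S.powerset.powerset.filter (IsNoncrossingFamily S)

theorem mem_ncFamilies {S : Finset α} {F : Finset (Finset α)} :
    F ∈ ncFamilies S ↔ IsNoncrossingFamily S F := by
  simp only [ncFamilies, mem_filter, mem_powerset, and_iff_right_iff_imp]
  exact fun h B hB => mem_powerset.2 (h.subset hB)

variable {R : Type*} [CommRing R]

/-- The sum over noncrossing partitions of `S` of the product of the weights of the block sizes. -/
noncomputable def ncSum (w : ℕ → R) (S : Finset α) : R :=
  ∑ F ∈ ncFamilies S, ∏ B ∈ F, w #B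

open Classical in
/-- Noncrossing partitions that refine a noncrossing partition are families of noncrossing
partitions of its blocks. -/
theorem sum_refining_families (w : ℕ → R) {ι : Type*} [Fintype ι] (T : ι → Finset α)
    (hd : ∀ i j x, x ∈ T i → x ∈ T j → i = j) (hu : ∀ i j, i ≠ j → Uncrossed (T i) (T j)) :
    ∑ F ∈ (ncFamilies (univ.biUnion T)).filter (fun F => ∀ B ∈ F, ∃ i, B ⊆ T i), ∏ B ∈ F, w #B =
      ∏ i, ncSum w (T i) := by
  unfold ncSum
  rw [prod_univ_sum]
  symm
  -- Blocks inside different `T i` cannot cross because the `T i` do not, so the choices on the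
  -- pieces are independent.
  refine sum_bij' (fun G _ => univ.biUnion G) (fun F _ i => F.filter (· ⊆ T i)) ?_ ?_ ?_ ?_ ?_
  · intro G hG
    have hG' (i) : IsNoncrossingFamily (T i) (G i) := mem_ncFamilies.1 (Fintype.mem_piFinset.1 hG i)
    rw [mem_filter, mem_ncFamilies]
    refine ⟨⟨?_, ?_, ?_, ?_⟩, ?_⟩
    · intro B hB
      obtain ⟨i, -, hi⟩ := mem_biUnion.1 hB
      exact (hG' i).nonempty B hi
    · intro A hA B hB x hxA hxB
      obtain ⟨i, -, hi⟩ := mem_biUnion.1 hA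
      obtain ⟨j, -, hj⟩ := mem_biUnion.1 hB
      obtain rfl := hd i j x ((hG' i).subset hi hxA) ((hG' j).subset hj hxB)
      exact (hG' i).eq_of_mem A hi B hj x hxA hxB
    · intro x
      simp only [mem_biUnion, mem_univ, true_and, (hG' _).mem_iff]
      tauto
    · intro A hA B hB hAB
      obtain ⟨i, -, hi⟩ := mem_biUnion.1 hA
      obtain ⟨j, -, hj⟩ := mem_biUnion.1 hB
      by_cases hij : i = j
      · subst hij
        exact (hG' i).uncrossed A hi B hj hAB
      · exact (hu i j hij).mono ((hG' i).subset hi) ((hG' j).subset hj)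
    · intro B hB
      obtain ⟨i, -, hi⟩ := mem_biUnion.1 hB
      exact ⟨i, (hG' i).subset hi⟩
  · intro F hF
    rw [mem_filter, mem_ncFamilies] at hF
    rw [Fintype.mem_piFinset]
    intro i
    rw [mem_ncFamilies]
    refine ⟨?_, ?_, ?_, ?_⟩
    · intro B hB
      exact hF.1.nonempty B (mem_filter.1 hB).1
    · intro A hA B hB
      exact hF.1.eq_of_mem A (mem_filter.1 hA).1 B (mem_filter.1 hB).1
    · intro x
      constructor
      · intro hx
        obtain ⟨B, hB, hxB⟩ := (hF.1.mem_iff x).1 (mem_biUnion.2 ⟨i, mem_univ i, hx⟩)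
        obtain ⟨j, hj⟩ := hF.2 B hB
        obtain rfl := hd i j x hx (hj hxB)
        exact ⟨B, mem_filter.2 ⟨hB, hj⟩, hxB⟩
      · rintro ⟨B, hB, hxB⟩
        exact (mem_filter.1 hB).2 hxB
    · intro A hA B hB
      exact hF.1.uncrossed A (mem_filter.1 hA).1 B (mem_filter.1 hB).1
  · intro G hG
    have hG' (i) : IsNoncrossingFamily (T i) (G i) := mem_ncFamilies.1 (Fintype.mem_piFinset.1 hG i)
    funext i
    ext B
    simp only [mem_filter, mem_biUnion, mem_univ, true_and]
    constructor
    · rintro ⟨⟨j, hj⟩, hB⟩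
      obtain ⟨x, hx⟩ := (hG' j).nonempty B hj
      obtain rfl := hd i j x (hB hx) ((hG' j).subset hj hx)
      exact hj
    · exact fun hB => ⟨⟨i, hB⟩, (hG' i).subset hB⟩
  · intro F hF
    rw [mem_filter, mem_ncFamilies] at hF
    ext B
    simp only [mem_filter, mem_biUnion, mem_univ, true_and]
    constructor
    · rintro ⟨j, hj, -⟩
      exact hj
    · intro hB
      obtain ⟨i, hi⟩ := hF.2 B hB
      exact ⟨i, hB, hi⟩
  · intro G hG
    have hG' (i) : IsNoncrossingFamily (T i) (G i) := mem_ncFamilies.1 (Fintype.mem_piFinset.1 hG i)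
    rw [prod_biUnion]
    intro i _ j _ hij
    rw [Function.onFun, disjoint_left]
    intro B hi hj
    obtain ⟨x, hx⟩ := (hG' j).nonempty B hj
    exact hij (hd i j x ((hG' i).subset hi hx) ((hG' j).subset hj hx))

/-- The elements of `S` below `B`. -/
def lowGap (S B : Finset α) : Finset α := S.filter fun x => ∀ b ∈ B, x < b

/-- The elements of `S` between `b` and the next element of `B`. -/
def gap (S B : Finset α) (b : α) : Finset α := S.filter fun x => b < x ∧ ∀ b' ∈ B, b' ≤ b ∨ x < b'

theorem gap_insert_of_mem {S B : Finset α} {a b : α} (ha : ∀ x ∈ S, a < x) (hb : b ∈ S) :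
    gap (insert a S) (insert a B) b = gap S B b := by
  ext x
  simp only [gap, mem_filter, mem_insert]
  constructor
  · rintro ⟨rfl | hx, hbx, h⟩
    · exact absurd (ha b hb) hbx.asymm
    · exact ⟨hx, hbx, fun b' hb' => h b' (Or.inr hb')⟩
  · rintro ⟨hx, hbx, h⟩
    refine ⟨Or.inr hx, hbx, ?_⟩
    rintro b' (rfl | hb')
    · exact Or.inl (ha b hb).le
    · exact h b' hb'

theorem gap_insert_self {S B : Finset α} {a : α} (ha : ∀ x ∈ S, a < x) (hB : B ⊆ S) :
    gap (insert a S) (insert a B) a = lowGap S B := by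
  ext x
  simp only [gap, lowGap, mem_filter, mem_insert]
  constructor
  · rintro ⟨rfl | hx, hbx, h⟩
    · exact absurd hbx (lt_irrefl _)
    · exact ⟨hx, fun b hb => (h b (Or.inr hb)).resolve_left (not_le.2 (ha b (hB hb)))⟩
  · rintro ⟨hx, h⟩
    refine ⟨Or.inr hx, ha x hx, ?_⟩
    rintro b' (rfl | hb')
    · exact Or.inl le_rfl
    · exact Or.inr (h b' hb')

theorem biUnion_gap {S B : Finset α} {a : α} (ha : ∀ x ∈ S, a ≤ x) (haB : a ∈ B) :
    (univ : Finset {b // b ∈ B}).biUnion (fun b => gap S B b) = S \ B := by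
  ext x
  simp only [mem_biUnion, mem_univ, true_and, gap, mem_filter, mem_sdiff, Subtype.exists]
  constructor
  · rintro ⟨b, hb, hx, hbx, h⟩
    refine ⟨hx, fun hxB => ?_⟩
    rcases h x hxB with h | h
    · exact absurd hbx h.not_gt
    · exact lt_irrefl _ h
  · rintro ⟨hx, hxB⟩
    -- The minimum `a` lies in B, so x has a largest predecessor in B, and that element owns the gap
    -- of x.
    have hne : (B.filter (· < x)).Nonempty :=
      ⟨a, mem_filter.2 ⟨haB, (ha x hx).lt_of_ne fun h => hxB (h ▸ haB)⟩⟩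
    have hm := mem_filter.1 (max'_mem _ hne)
    refine ⟨_, hm.1, hx, hm.2, fun b' hb' => ?_⟩
    rcases lt_trichotomy b' x with h | h | h
    · exact Or.inl (le_max' _ _ (mem_filter.2 ⟨hb', h⟩))
    · exact absurd (h ▸ hb') hxB
    · exact Or.inr h

theorem lt_of_mem_gap_of_lt {S B : Finset α} {b b' x y : α} (hb' : b' ∈ B) (h : b < b')
    (hx : x ∈ gap S B b) (hy : y ∈ gap S B b') : x < y := by
  simp only [gap, mem_filter] at hx hy
  exact ((hx.2.2 b' hb').resolve_left (not_le.2 h)).trans hy.2.1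

theorem eq_of_mem_gap {S B : Finset α} {b b' x : α} (hb : b ∈ B) (hb' : b' ∈ B)
    (hx : x ∈ gap S B b) (hy : x ∈ gap S B b') : b = b' := by
  rcases lt_trichotomy b b' with h | h | h
  · exact absurd (lt_of_mem_gap_of_lt hb' h hx hy) (lt_irrefl _)
  · exact h
  · exact absurd (lt_of_mem_gap_of_lt hb h hy hx) (lt_irrefl _)

theorem uncrossed_gap {S B : Finset α} {b b' : α} (hb : b ∈ B) (hb' : b' ∈ B) (h : b ≠ b') :
    Uncrossed (gap S B b) (gap S B b') := by
  intro i hi j hj k hk l hl hij hjk _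
  rcases h.lt_or_gt with h | h
  · exact (lt_of_mem_gap_of_lt hb' h hk hj).asymm hjk
  · exact (lt_of_mem_gap_of_lt hb h hj hi).asymm hij

theorem uncrossed_of_subset_gap {S B C : Finset α} {b : α} (h : C ⊆ gap S B b) :
    Uncrossed B C ∧ Uncrossed C B := by
  have key : ∀ i ∈ C, ∀ j ∈ B, ∀ k ∈ C, i < j → ¬ j < k := by
    intro i hi j hj k hk hij hjk
    have hi' := mem_filter.1 (h hi)
    have hk' := mem_filter.1 (h hk)
    rcases hk'.2.2 j hj with h | h
    · exact (h.trans_lt hi'.2.1).asymm hij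
    · exact h.asymm hjk
  exact ⟨fun i hi j hj k hk l hl _ h => key j hj k hk l hl h,
    fun i hi j hj k hk l hl h h' _ => key i hi j hj k hk h h'⟩

/-- If C had x in the gap after b and y in the gap after a later b', then b < x < b' < y would be a
crossing. -/
theorem exists_subset_gap_of_uncrossed {S B C : Finset α} {a : α} (ha : ∀ x ∈ S, a ≤ x)
    (haB : a ∈ B) (hC : C ⊆ S \ B) (hCne : C.Nonempty) (h : Uncrossed B C) :
    ∃ b : {b // b ∈ B}, C ⊆ gap S B b := by
  have hmem (x) (hx : x ∈ C) : ∃ b ∈ B, x ∈ gap S B b := by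
    have := hC hx
    rw [← biUnion_gap ha haB] at this
    simpa using this
  have key : ∀ x ∈ C, ∀ y ∈ C, ∀ b ∈ B, ∀ b' ∈ B, x ∈ gap S B b → y ∈ gap S B b' → ¬ b < b' := by
    intro x hx y hy b hb b' hb' hxb hyb hlt
    have hx' := (mem_filter.1 hxb).2
    have hy' := (mem_filter.1 hyb).2
    exact h b hb x hx b' hb' y hy hx'.1 ((hx'.2 b' hb').resolve_left (not_le.2 hlt)) hy'.1
  obtain ⟨x, hx⟩ := hCne
  obtain ⟨b, hb, hxb⟩ := hmem x hx
  refine ⟨⟨b, hb⟩, fun y hy => ?_⟩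
  obtain ⟨b', hb', hyb⟩ := hmem y hy
  have : b = b' := le_antisymm (not_lt.1 (key y hy x hx b' hb' b hb hyb hxb))
    (not_lt.1 (key x hx y hy b hb b' hb' hxb hyb))
  subst this
  exact hyb

end NoncrossingFamilies

/-! ### The functional equation for weighted noncrossing partitions. -/

section NoncrossingRecursion

open Finset PowerSeries

variable {α : Type} [LinearOrder α] {R : Type*} [CommRing R]

-- Once B is removed, each remaining block sits in a single gap of B, and conversely gaps can be
-- filled independently; the sum then factors by `sum_refining_families`.
open Classical in
theorem sum_families_containing (w : ℕ → R) {S B : Finset α} {a : α} (ha : ∀ x ∈ S, a ≤ x)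
    (haB : a ∈ B) (hB : B ⊆ S) :
    ∑ F ∈ (ncFamilies S).filter (B ∈ ·), ∏ C ∈ F, w #C = w #B * ∏ b ∈ B, ncSum w (gap S B b) := by
  have h := sum_refining_families w (fun b : {b // b ∈ B} => gap S B b)
    (fun i j x hi hj => Subtype.ext (eq_of_mem_gap i.2 j.2 hi hj))
    (fun i j hij => uncrossed_gap i.2 j.2 fun h => hij (Subtype.ext h))
  rw [biUnion_gap ha haB, ← prod_coe_sort B fun b => ncSum w (gap S B b)] at *
  rw [← h, mul_sum]
  refine sum_bij' (fun F _ => F.erase B) (fun F _ => insert B F) ?_ ?_ ?_ ?_ ?_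
  · intro F hF
    rw [mem_filter, mem_ncFamilies] at hF
    have hsub : ∀ C ∈ F.erase B, C ⊆ S \ B := by
      intro C hC x hx
      refine mem_sdiff.2 ⟨hF.1.subset (mem_of_mem_erase hC) hx, fun hxB => ?_⟩
      exact ne_of_mem_erase hC (hF.1.eq_of_mem C (mem_of_mem_erase hC) B hF.2 x hx hxB)
    rw [mem_filter, mem_ncFamilies]
    refine ⟨⟨?_, ?_, ?_, ?_⟩, ?_⟩
    · exact fun C hC => hF.1.nonempty C (mem_of_mem_erase hC)
    · exact fun C hC D hD => hF.1.eq_of_mem C (mem_of_mem_erase hC) D (mem_of_mem_erase hD)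
    · intro x
      constructor
      · intro hx
        obtain ⟨C, hC, hxC⟩ := (hF.1.mem_iff x).1 (mem_sdiff.1 hx).1
        exact ⟨C, mem_erase.2 ⟨fun h => (mem_sdiff.1 hx).2 (h ▸ hxC), hC⟩, hxC⟩
      · rintro ⟨C, hC, hxC⟩
        exact hsub C hC hxC
    · exact fun C hC D hD => hF.1.uncrossed C (mem_of_mem_erase hC) D (mem_of_mem_erase hD)
    · intro C hC
      exact exists_subset_gap_of_uncrossed ha haB (hsub C hC)
        (hF.1.nonempty C (mem_of_mem_erase hC))
        (hF.1.uncrossed B hF.2 C (mem_of_mem_erase hC) (ne_of_mem_erase hC).symm)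
  · intro F hF
    rw [mem_filter, mem_ncFamilies] at hF
    have hdis : ∀ C ∈ F, ∀ x ∈ C, x ∉ B := fun C hC x hx => (mem_sdiff.1 (hF.1.subset hC hx)).2
    rw [mem_filter, mem_ncFamilies]
    refine ⟨⟨?_, ?_, ?_, ?_⟩, mem_insert_self _ _⟩
    · intro C hC
      rcases mem_insert.1 hC with rfl | hC
      · exact ⟨a, haB⟩
      · exact hF.1.nonempty C hC
    · intro C hC D hD x hxC hxD
      rcases mem_insert.1 hC with rfl | hC'
      · rcases mem_insert.1 hD with rfl | hD'
        · rfl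
        · exact absurd hxC (hdis D hD' x hxD)
      · rcases mem_insert.1 hD with rfl | hD'
        · exact absurd hxD (hdis C hC' x hxC)
        · exact hF.1.eq_of_mem C hC' D hD' x hxC hxD
    · intro x
      constructor
      · intro hx
        by_cases hxB : x ∈ B
        · exact ⟨B, mem_insert_self _ _, hxB⟩
        · obtain ⟨C, hC, hxC⟩ := (hF.1.mem_iff x).1 (mem_sdiff.2 ⟨hx, hxB⟩)
          exact ⟨C, mem_insert_of_mem hC, hxC⟩
      · rintro ⟨C, hC, hxC⟩
        rcases mem_insert.1 hC with rfl | hC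
        · exact hB hxC
        · exact (mem_sdiff.1 (hF.1.subset hC hxC)).1
    · intro C hC D hD hCD
      rcases mem_insert.1 hC with rfl | hC'
      · rcases mem_insert.1 hD with rfl | hD'
        · exact absurd rfl hCD
        · obtain ⟨i, hi⟩ := hF.2 D hD'
          exact (uncrossed_of_subset_gap hi).1
      · rcases mem_insert.1 hD with rfl | hD'
        · obtain ⟨i, hi⟩ := hF.2 C hC'
          exact (uncrossed_of_subset_gap hi).2
        · exact hF.1.uncrossed C hC' D hD' hCD
  · intro F hF
    exact insert_erase (mem_filter.1 hF).2
  · intro F hF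
    rw [mem_filter, mem_ncFamilies] at hF
    refine erase_insert fun hBF => ?_
    exact (mem_sdiff.1 (hF.1.subset hBF haB)).2 haB
  · intro F hF
    exact (mul_prod_erase F (fun C => w #C) (mem_filter.1 hF).2).symm

/-- Decomposition of the sum over noncrossing partitions by the block of the smallest element. -/
theorem ncSum_insert (w : ℕ → R) {S : Finset α} {a : α} (ha : ∀ x ∈ S, a < x) :
    ncSum w (insert a S) = ∑ B ∈ S.powerset,
      w (#B + 1) * (ncSum w (lowGap S B) * ∏ b ∈ B, ncSum w (gap S B b)) := by
  classical
  have haS : a ∉ S := fun h => lt_irrefl _ (ha a h)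
  -- Exactly one block of F contains `a`, so only one of the indicator terms survives.
  have h1 : ∀ F ∈ ncFamilies (insert a S), ∏ C ∈ F, w #C =
      ∑ B ∈ S.powerset, if insert a B ∈ F then ∏ C ∈ F, w #C else 0 := by
    intro F hF
    rw [mem_ncFamilies] at hF
    obtain ⟨C, hC, haC⟩ := (hF.mem_iff a).1 (mem_insert_self _ _)
    have e : insert a (C.erase a) = C := insert_erase haC
    rw [sum_eq_single (C.erase a), e, if_pos hC]
    · intro B hB hne
      refine if_neg fun hBF => hne ?_
      rw [hF.eq_of_mem C hC _ hBF a haC (mem_insert_self _ _), erase_insert]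
      exact fun h => haS (mem_powerset.1 hB h)
    · intro h
      refine absurd (mem_powerset.2 fun x hx => ?_) h
      exact (mem_insert.1 (hF.subset hC (mem_of_mem_erase hx))).resolve_left (ne_of_mem_erase hx)
  rw [ncSum, sum_congr rfl h1, sum_comm]
  refine sum_congr rfl fun B hB => ?_
  have hB := mem_powerset.1 hB
  rw [← sum_filter, sum_families_containing w (a := a) _ (mem_insert_self _ _)
    (insert_subset_insert a hB), card_insert_of_notMem fun h => haS (hB h),
    prod_insert fun h => haS (hB h), gap_insert_self ha hB]
  · congr 2
    exact prod_congr rfl fun b hb => by rw [gap_insert_of_mem ha (hB hb)]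
  · intro x hx
    rcases mem_insert.1 hx with rfl | hx
    · exact le_rfl
    · exact (ha x hx).le

/-- Only the position of b in the order matters; this turns a sum over a largest chosen point into a
convolution of coefficients. -/
theorem sum_card_lt_card_gt {M : Type*} [AddCommMonoid M] (S : Finset α) (f : ℕ → ℕ → M) :
    ∑ b ∈ S, f #(S.filter (· < b)) #(S.filter (b < ·)) = ∑ i ∈ range #S, f i (#S - 1 - i) := by
  induction S using Finset.induction_on_max generalizing f with
  | empty => simp
  | insert x S hx ih =>
    have hxS : x ∉ S := fun h => lt_irrefl _ (hx x h)
    rw [sum_insert hxS, card_insert_of_notMem hxS, sum_range_succ, add_comm]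
    congr 1
    · have h : ∀ b ∈ S, f #((insert x S).filter (· < b)) #((insert x S).filter (b < ·)) =
          f #(S.filter (· < b)) (#(S.filter (b < ·)) + 1) := by
        intro b hb
        rw [filter_insert, filter_insert, if_neg (hx b hb).asymm, if_pos (hx b hb),
          card_insert_of_notMem fun h => hxS (mem_filter.1 h).1]
      rw [sum_congr rfl h, ih fun i j => f i (j + 1)]
      refine sum_congr rfl fun i hi => ?_
      have := mem_range.1 hi
      congr 1
      omega
    · rw [filter_insert, if_neg (lt_irrefl _), filter_insert, if_neg (lt_irrefl _),
        filter_true_of_mem hx, filter_false_of_mem fun y hy => (hx y hy).asymm]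
      simp

/-- Summation over `s + 1` element subsets by the largest element. -/
theorem sum_powersetCard_succ_by_max {M : Type*} [AddCommMonoid M] (S : Finset α) (s : ℕ)
    (f : Finset α → M) :
    ∑ B ∈ S.powersetCard (s + 1), f B =
      ∑ b ∈ S, ∑ B ∈ (S.filter (· < b)).powersetCard s, f (insert b B) := by
  rw [sum_sigma']
  symm
  refine sum_bij (fun p _ => insert p.1 p.2) ?_ ?_ ?_ ?_
  · rintro ⟨b, B⟩ h
    simp only [mem_sigma, mem_powersetCard] at h ⊢
    obtain ⟨hb, hB, hs⟩ := h
    refine ⟨insert_subset hb (hB.trans (filter_subset _ _)), ?_⟩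
    rw [card_insert_of_notMem, hs]
    exact fun h => lt_irrefl _ (mem_filter.1 (hB h)).2
  · rintro ⟨b, B⟩ h ⟨c, C⟩ h' heq
    simp only [mem_sigma, mem_powersetCard] at h h' heq
    have hlt : ∀ x ∈ B, x < b := fun x hx => (mem_filter.1 (h.2.1 hx)).2
    have hlt' : ∀ x ∈ C, x < c := fun x hx => (mem_filter.1 (h'.2.1 hx)).2
    have hbc : b = c := by
      apply le_antisymm
      · have : b ∈ insert c C := heq ▸ mem_insert_self _ _
        rcases mem_insert.1 this with h | h
        · exact h.le
        · exact (hlt' b h).le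
      · have : c ∈ insert b B := heq ▸ mem_insert_self _ _
        rcases mem_insert.1 this with h | h
        · exact h.le
        · exact (hlt c h).le
    subst hbc
    have : B = C := by
      rw [← erase_insert fun h => lt_irrefl _ (hlt b h), heq,
        erase_insert fun h => lt_irrefl _ (hlt' b h)]
    rw [this]
  · intro B hB
    rw [mem_powersetCard] at hB
    have hne : B.Nonempty := card_pos.1 (by omega)
    refine ⟨⟨B.max' hne, B.erase (B.max' hne)⟩, ?_, insert_erase (max'_mem B hne)⟩
    simp only [mem_sigma, mem_powersetCard]
    refine ⟨hB.1 (max'_mem B hne), fun x hx => mem_filter.2 ⟨hB.1 (mem_of_mem_erase hx), ?_⟩, ?_⟩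
    · exact lt_of_le_of_ne (le_max' B x (mem_of_mem_erase hx)) (ne_of_mem_erase hx)
    · rw [card_erase_of_mem (max'_mem B hne), hB.2, Nat.add_sub_cancel]
  · intros; rfl

/-- The s chosen points cut the rest of S into s + 1 intervals of arbitrary sizes, whence the power
s + 1 of the series; Xˢ accounts for the points. The induction peels off the largest one. -/
theorem sum_prod_gap (m : ℕ → R) (S : Finset α) (s : ℕ) :
    ∑ B ∈ S.powersetCard s, m #(lowGap S B) * ∏ b ∈ B, m #(gap S B b) =
      coeff #S (X ^ s * PowerSeries.mk m ^ (s + 1)) := by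
  induction s generalizing S with
  | zero => simp [lowGap]
  | succ s ih =>
    have h : ∀ b ∈ S, ∑ B ∈ (S.filter (· < b)).powersetCard s,
        (m #(lowGap S (insert b B)) * ∏ c ∈ insert b B, m #(gap S (insert b B) c)) =
        coeff #(S.filter (· < b)) (X ^ s * PowerSeries.mk m ^ (s + 1)) *
          m #(S.filter (b < ·)) := by
      intro b hb
      rw [← ih, sum_mul]
      refine sum_congr rfl fun B hB => ?_
      have hB := (mem_powersetCard.1 hB).1
      have hlt : ∀ x ∈ B, x < b := fun x hx => (mem_filter.1 (hB hx)).2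
      have e1 : lowGap S (insert b B) = lowGap (S.filter (· < b)) B := by
        ext x; simp [lowGap, and_assoc]
      have e2 : gap S (insert b B) b = S.filter (b < ·) := by
        ext x
        simp only [gap, mem_filter, and_congr_right_iff, and_iff_left_iff_imp, mem_insert]
        rintro - - c (rfl | hc)
        · exact Or.inl le_rfl
        · exact Or.inl (hlt c hc).le
      have e3 : ∀ c ∈ B, gap S (insert b B) c = gap (S.filter (· < b)) B c := by
        intro c hc
        ext x
        simp only [gap, mem_filter, mem_insert, forall_eq_or_imp, not_le.2 (hlt c hc), false_or]
        tauto
      rw [prod_insert fun h => lt_irrefl _ (hlt b h), e1, e2,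
        prod_congr rfl fun c hc => by rw [e3 c hc]]
      ring
    rw [sum_powersetCard_succ_by_max, sum_congr rfl h,
      sum_card_lt_card_gt S fun i j => coeff i (X ^ s * PowerSeries.mk m ^ (s + 1)) * m j]
    have e : X ^ (s + 1) * PowerSeries.mk m ^ (s + 1 + 1) =
        X * (X ^ s * PowerSeries.mk m ^ (s + 1) * PowerSeries.mk m) := by ring
    rw [e]
    cases hS : #S with
    | zero => simp
    | succ N =>
      rw [coeff_succ_X_mul, coeff_mul, Finset.Nat.sum_antidiagonal_eq_sum_range_succ_mk]
      exact sum_congr rfl fun i _ => by simp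

theorem ncSum_insert_of_forall (w m : ℕ → R) {S : Finset α} {a : α} (ha : ∀ x ∈ S, a < x)
    (hm : ∀ T ⊆ S, ncSum w T = m #T) :
    ncSum w (insert a S) = ∑ s ∈ range (#S + 1),
      w (s + 1) * coeff #S (X ^ s * PowerSeries.mk m ^ (s + 1)) := by
  rw [ncSum_insert w ha, sum_powerset]
  refine sum_congr rfl fun s _ => ?_
  rw [← sum_prod_gap, mul_sum]
  refine sum_congr rfl fun B hB => ?_
  rw [(mem_powersetCard.1 hB).2, hm (lowGap S B) (filter_subset _ _),
    prod_congr rfl fun b _ => hm (gap S B b) (filter_subset _ _)]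

theorem ncSum_empty (w : ℕ → R) : ncSum w (∅ : Finset α) = 1 := by
  have : ncFamilies (∅ : Finset α) = {∅} := by
    ext F
    rw [mem_ncFamilies, mem_singleton]
    constructor
    · intro h
      rw [eq_empty_iff_forall_notMem]
      intro B hB
      obtain ⟨x, hx⟩ := h.nonempty B hB
      exact notMem_empty x (h.subset hB hx)
    · rintro rfl
      exact ⟨by simp, by simp, by simp, by simp⟩
  simp [ncSum, this]

/-- The recursion on the block of the minimum involves only cardinalities. The order varies inside
the induction so that S can be compared with a range of naturals. -/
theorem ncSum_eq_ncSum_range (w : ℕ → R) (N : ℕ) :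
    ∀ {α : Type} [LinearOrder α] (S : Finset α), #S = N → ncSum w S = ncSum w (range N) := by
  induction N using Nat.strong_induction_on with
  | _ N ih =>
    have key : ∀ {α : Type} [LinearOrder α] (S : Finset α), #S = N → ∀ hS : S.Nonempty,
        ncSum w S = ∑ s ∈ range (N - 1 + 1), w (s + 1) *
          coeff (N - 1) (X ^ s * PowerSeries.mk (fun n => ncSum w (range n)) ^ (s + 1)) := by
      intro α _ S hS hne
      have hcard : #(S.erase (S.min' hne)) = N - 1 := by rw [card_erase_of_mem (min'_mem _ _), hS]
      have hpos : 0 < N := hS ▸ card_pos.2 hne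
      have h := ncSum_insert_of_forall w (fun n => ncSum w (range n))
        (S := S.erase (S.min' hne)) (a := S.min' hne)
        (fun x hx => lt_of_le_of_ne (min'_le _ _ (mem_of_mem_erase hx)) (ne_of_mem_erase hx).symm)
        (fun T hT => ih #T (by have := card_le_card hT; omega) T rfl)
      rwa [insert_erase (min'_mem _ _), hcard] at h
    intro α _ S hS
    rcases S.eq_empty_or_nonempty with rfl | hne
    · simp only [card_empty] at hS
      subst hS
      rw [range_zero, ncSum_empty, ncSum_empty]
    · have hpos : 0 < N := hS ▸ card_pos.2 hne
      rw [key S hS hne, key (range N) (card_range N) (nonempty_range_iff.2 hpos.ne')]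

/-- The generating function of weighted noncrossing partitions. -/
noncomputable def ncSeries (w : ℕ → R) : R⟦X⟧ := PowerSeries.mk fun n => ncSum w (range n)

theorem ncSum_eq_coeff (w : ℕ → R) (S : Finset α) : ncSum w S = coeff #S (ncSeries w) := by
  rw [ncSeries, coeff_mk, ncSum_eq_ncSum_range w _ S rfl]

/-- A first block of size p leaves p gaps, contributing w(p)(XM)ᵖ. The term p = 0 is the empty
partition, hence the condition on `w 0`. -/
theorem ncSeries_eq_subst (w : ℕ → R) (hw : w 0 = 1) :
    ncSeries w = (PowerSeries.mk w).subst (X * ncSeries w) := by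
  have hu : constantCoeff (X * ncSeries w) = 0 := by simp
  ext n
  rw [coeff_subst_eq_sum hu _ le_rfl, ← card_range n, ← ncSum_eq_coeff, card_range]
  cases n with
  | zero => simp [ncSum_empty, hw]
  | succ n =>
    obtain ⟨S, a, ha, hS, hins⟩ : ∃ (S : Finset ℕ) (a : ℕ), (∀ x ∈ S, a < x) ∧ #S = n ∧
        #(insert a S) = n + 1 := by
      refine ⟨Ico 1 (n + 1), 0, fun x hx => (mem_Ico.1 hx).1, by simp, ?_⟩
      rw [card_insert_of_notMem (by simp)]; simp
    rw [ncSum_eq_coeff, card_range, ← hins, ← ncSum_eq_coeff,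
      ncSum_insert_of_forall w (fun n => ncSum w (range n)) ha
        (fun T _ => ncSum_eq_ncSum_range w _ T rfl), hS, hins, sum_range_succ' _ (n + 1)]
    rw [pow_zero, coeff_one, if_neg n.succ_ne_zero, mul_zero, add_zero]
    refine sum_congr rfl fun s _ => ?_
    have : (X * ncSeries w) ^ (s + 1) = X * (X ^ s * ncSeries w ^ (s + 1)) := by ring
    rw [this, coeff_succ_X_mul, coeff_mk, ncSeries]

end NoncrossingRecursion

/-! ### Merging blocks of a noncrossing partition. -/

section MergingBlocks

open Finset

variable {n : ℕ}

/-- Noncrossing means that no block separates the elements of another block. -/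
theorem isNoncrossing_iff_not_separated {P : Finpartition (univ : Finset (Fin n))} :
    IsNoncrossing P ↔ ∀ A ∈ P.parts, ∀ C ∈ P.parts, A ≠ C → ∀ c ∈ C, ∀ d ∈ C, ∀ x ∈ A, ∀ y ∈ A,
      c < x → x < d → c < y ∧ y < d := by
  have hne : ∀ A ∈ P.parts, ∀ C ∈ P.parts, A ≠ C → ∀ x ∈ A, ∀ y ∈ C, x ≠ y := by
    rintro A hA C hC hAC x hx y hy rfl
    exact hAC (P.eq_of_mem_parts hA hC hx hy)
  constructor
  · intro h A hA C hC hAC c hc d hd x hx y hy hcx hxd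
    have h1 := hne A hA C hC hAC y hy c hc
    have h2 := hne A hA C hC hAC y hy d hd
    constructor
    · by_contra hcy
      exact h A hA C hC hAC ⟨y, c, x, d, lt_of_le_of_ne (not_lt.1 hcy) h1, hcx, hxd, hy, hx, hc, hd⟩
    · by_contra hyd
      exact h C hC A hA hAC.symm
        ⟨c, x, d, y, hcx, hxd, lt_of_le_of_ne (not_lt.1 hyd) h2.symm, hc, hd, hx, hy⟩
  · rintro h A hA C hC hAC ⟨i, j, k, l, hij, hjk, hkl, hi, hk, hj, hl⟩
    exact (h A hA C hC hAC j hj l hl k hk i hi hjk hkl).1.asymm hij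

/-- Otherwise consecutive integers always share a block and there is only one block. -/
theorem exists_adjacent_of_one_lt_card {P : Finpartition (univ : Finset (Fin n))}
    (h : 1 < #P.parts) : ∃ A ∈ P.parts, ∃ B ∈ P.parts, A ≠ B ∧ ∃ x ∈ A, ∃ y ∈ B,
      (x : ℕ) + 1 = y := by
  by_contra! hcon
  obtain ⟨A, hA, B, hB, hAB⟩ := one_lt_card.1 h
  have key : ∀ i : ℕ, ∀ (hi : i < n) (h0 : 0 < n), P.part ⟨i, hi⟩ = P.part ⟨0, h0⟩ := by
    intro i
    induction i with
    | zero => intros; rfl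
    | succ i ih =>
      intro hi h0
      rw [← ih (by omega) h0]
      by_contra hne
      exact hcon _ (P.part_mem.2 (mem_univ ⟨i, by omega⟩)) _ (P.part_mem.2 (mem_univ ⟨i + 1, hi⟩))
        (Ne.symm hne) _ (P.mem_part_self.2 (mem_univ _)) _ (P.mem_part_self.2 (mem_univ _)) rfl
  obtain ⟨a, ha⟩ := P.nonempty_of_mem_parts hA
  obtain ⟨b, hb⟩ := P.nonempty_of_mem_parts hB
  apply hAB
  rw [← P.part_eq_of_mem hA ha, ← P.part_eq_of_mem hB hb,
    key a a.2 (by have := a.2; omega), key b b.2 (by have := a.2; omega)]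

/-- Merging two blocks of a partition. -/
def mergeBlocks (P : Finpartition (univ : Finset (Fin n))) {A B : Finset (Fin n)}
    (hA : A ∈ P.parts) (hB : B ∈ P.parts) : Finpartition (univ : Finset (Fin n)) :=
  Finpartition.ofExistsUnique (insert (A ∪ B) ((P.parts.erase A).erase B))
    (fun _ _ => subset_univ _)
    (by
      intro x _
      by_cases hx : x ∈ A ∪ B
      · refine ⟨A ∪ B, ⟨mem_insert_self _ _, hx⟩, ?_⟩
        rintro C ⟨hC, hxC⟩
        rcases mem_insert.1 hC with rfl | hC
        · rfl
        · have hCP := mem_of_mem_erase (mem_of_mem_erase hC)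
          rcases mem_union.1 hx with hx | hx
          · exact absurd (P.eq_of_mem_parts hCP hA hxC hx) (ne_of_mem_erase (mem_of_mem_erase hC))
          · exact absurd (P.eq_of_mem_parts hCP hB hxC hx) (ne_of_mem_erase hC)
      · obtain ⟨D, ⟨hD, hxD⟩, -⟩ := P.existsUnique_mem (mem_univ x)
        refine ⟨D, ⟨mem_insert_of_mem (mem_erase.2 ⟨?_, mem_erase.2 ⟨?_, hD⟩⟩), hxD⟩, ?_⟩
        · rintro rfl
          exact hx (mem_union_right _ hxD)
        · rintro rfl
          exact hx (mem_union_left _ hxD)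
        · rintro C ⟨hC, hxC⟩
          rcases mem_insert.1 hC with rfl | hC
          · exact absurd hxC hx
          · exact P.eq_of_mem_parts (mem_of_mem_erase (mem_of_mem_erase hC)) hD hxC hxD)
    (by
      intro h
      rcases mem_insert.1 h with h | h
      · obtain ⟨x, hx⟩ := P.nonempty_of_mem_parts hA
        exact notMem_empty x (h ▸ mem_union_left _ hx)
      · exact P.empty_notMem_parts (mem_of_mem_erase (mem_of_mem_erase h)))

theorem mem_mergeBlocks {P : Finpartition (univ : Finset (Fin n))} {A B C : Finset (Fin n)}
    (hA : A ∈ P.parts) (hB : B ∈ P.parts) :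
    C ∈ (mergeBlocks P hA hB).parts ↔ C = A ∪ B ∨ C ≠ B ∧ C ≠ A ∧ C ∈ P.parts := by
  simp [mergeBlocks]

theorem le_mergeBlocks {P : Finpartition (univ : Finset (Fin n))} {A B : Finset (Fin n)}
    (hA : A ∈ P.parts) (hB : B ∈ P.parts) : P ≤ mergeBlocks P hA hB := by
  intro C hC
  by_cases hCA : C = A
  · exact ⟨A ∪ B, (mem_mergeBlocks hA hB).2 (Or.inl rfl), hCA ▸ subset_union_left⟩
  by_cases hCB : C = B
  · exact ⟨A ∪ B, (mem_mergeBlocks hA hB).2 (Or.inl rfl), hCB ▸ subset_union_right⟩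
  exact ⟨C, (mem_mergeBlocks hA hB).2 (Or.inr ⟨hCB, hCA, hC⟩), le_rfl⟩

theorem union_notMem_parts {P : Finpartition (univ : Finset (Fin n))} {A B : Finset (Fin n)}
    (hA : A ∈ P.parts) (hB : B ∈ P.parts) (hAB : A ≠ B) : A ∪ B ∉ P.parts := by
  intro h
  obtain ⟨a, ha⟩ := P.nonempty_of_mem_parts hA
  obtain ⟨b, hb⟩ := P.nonempty_of_mem_parts hB
  exact hAB ((P.eq_of_mem_parts hA h ha (mem_union_left _ ha)).trans
    (P.eq_of_mem_parts hB h hb (mem_union_right _ hb)).symm)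

theorem card_mergeBlocks {P : Finpartition (univ : Finset (Fin n))} {A B : Finset (Fin n)}
    (hA : A ∈ P.parts) (hB : B ∈ P.parts) (hAB : A ≠ B) :
    #(mergeBlocks P hA hB).parts + 1 = #P.parts := by
  have h : 1 < #P.parts := one_lt_card.2 ⟨A, hA, B, hB, hAB⟩
  rw [mergeBlocks, Finpartition.ofExistsUnique_parts, card_insert_of_notMem fun h =>
    union_notMem_parts hA hB hAB (mem_of_mem_erase (mem_of_mem_erase h)),
    card_erase_of_mem (mem_erase.2 ⟨hAB.symm, hB⟩), card_erase_of_mem hA]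
  omega

theorem isNoncrossing_mergeBlocks {P : Finpartition (univ : Finset (Fin n))} (hP : IsNoncrossing P)
    {A B : Finset (Fin n)} (hA : A ∈ P.parts) (hB : B ∈ P.parts) {a b : Fin n} (ha : a ∈ A)
    (hb : b ∈ B) (hab : (a : ℕ) + 1 = b) : IsNoncrossing (mergeBlocks P hA hB) := by
  have hP' := isNoncrossing_iff_not_separated.1 hP
  have key : ∀ C ∈ P.parts, C ≠ A → C ≠ B → ∀ c ∈ C, ∀ d ∈ C, ∀ x ∈ A ∪ B, ∀ y ∈ A ∪ B,
      c < x → x < d → c < y ∧ y < d := by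
    intro C hC hCA hCB c hc d hd x hx y hy hcx hxd
    have hne (z) (hz : z ∈ C) : a ≠ z ∧ b ≠ z :=
      ⟨fun h => hCA (P.eq_of_mem_parts hC hA (h ▸ hz) ha),
        fun h => hCB (P.eq_of_mem_parts hC hB (h ▸ hz) hb)⟩
    -- No element of C fits between the adjacent `a` and `b`, so the two lie on the same side of any
    -- pair from C; this ties the position of A to that of B.
    have iff : (c < a ∧ a < d) ↔ (c < b ∧ b < d) := by
      have h1 := hne c hc
      have h2 := hne d hd
      simp only [Fin.lt_def, ne_eq, Fin.ext_iff] at *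
      omega
    have hA' : ∀ x ∈ A, ∀ y ∈ A, c < x ∧ x < d → c < y ∧ y < d := fun x hx y hy h =>
      hP' A hA C hC hCA.symm c hc d hd x hx y hy h.1 h.2
    have hB' : ∀ x ∈ B, ∀ y ∈ B, c < x ∧ x < d → c < y ∧ y < d := fun x hx y hy h =>
      hP' B hB C hC hCB.symm c hc d hd x hx y hy h.1 h.2
    have ha' : c < a ∧ a < d := by
      rcases mem_union.1 hx with hx | hx
      · exact hA' x hx a ha ⟨hcx, hxd⟩
      · exact iff.2 (hB' x hx b hb ⟨hcx, hxd⟩)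
    rcases mem_union.1 hy with hy | hy
    · exact hA' a ha y hy ha'
    · exact hB' b hb y hy (iff.1 ha')
  have key' : ∀ C ∈ P.parts, C ≠ A → C ≠ B → ¬ ∃ i j k l : Fin n, i < j ∧ j < k ∧ k < l ∧
      i ∈ C ∧ k ∈ C ∧ j ∈ A ∪ B ∧ l ∈ A ∪ B := by
    rintro C hC hCA hCB ⟨i, j, k, l, hij, hjk, hkl, hi, hk, hj, hl⟩
    exact (key C hC hCA hCB i hi k hk j hj l hl hij hjk).2.asymm hkl
  have key'' : ∀ C ∈ P.parts, C ≠ A → C ≠ B → ¬ ∃ i j k l : Fin n, i < j ∧ j < k ∧ k < l ∧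
      i ∈ A ∪ B ∧ k ∈ A ∪ B ∧ j ∈ C ∧ l ∈ C := by
    rintro C hC hCA hCB ⟨i, j, k, l, hij, hjk, hkl, hi, hk, hj, hl⟩
    exact (key C hC hCA hCB j hj l hl k hk i hi hjk hkl).1.asymm hij
  intro C hC D hD hCD
  rw [mem_mergeBlocks] at hC hD
  rcases hC with rfl | ⟨hCB, hCA, hC⟩
  · rcases hD with rfl | ⟨hDB, hDA, hD⟩
    · exact absurd rfl hCD
    · exact key'' D hD hDA hDB
  · rcases hD with rfl | ⟨hDB, hDA, hD⟩
    · exact key' C hC hCA hCB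
    · exact hP C hC D hD hCD

/-- Choosing a block of P inside each block of Q is injective; by the count it exhausts P, so every
block of Q is a single block of P. -/
theorem eq_of_le_of_card_le {P Q : Finpartition (univ : Finset (Fin n))} (h : P ≤ Q)
    (hc : #P.parts ≤ #Q.parts) : P = Q := by
  choose! g hg hgC using fun C (hC : C ∈ Q.parts) => Finpartition.exists_le_of_le h hC
  have hdisj : ∀ C ∈ Q.parts, ∀ D ∈ Q.parts, ∀ x ∈ g C, x ∈ D → C = D := fun C hC D hD x hx hxD =>
    Q.eq_of_mem_parts hC hD (hgC C hC hx) hxD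
  have hinj : Set.InjOn g Q.parts := by
    intro C hC D hD hCD
    obtain ⟨x, hx⟩ := P.nonempty_of_mem_parts (hg C hC)
    exact hdisj C hC D hD x hx (hgC D hD (hCD ▸ hx))
  have himg : Q.parts.image g = P.parts :=
    eq_of_subset_of_card_le (image_subset_iff.2 hg) (by rwa [card_image_of_injOn hinj])
  have hsub : Q.parts ⊆ P.parts := by
    intro C hC
    have : C ⊆ g C := by
      intro x hxC
      obtain ⟨B, hB, hxB⟩ := P.exists_mem (mem_univ x)
      obtain ⟨D, hD, rfl⟩ := mem_image.1 (himg ▸ hB)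
      rwa [← hdisj D hD C hC x hxB hxC]
    rw [this.antisymm (hgC C hC)]
    exact hg C hC
  exact (Finpartition.ext (eq_of_subset_of_card_le hsub hc)).symm

end MergingBlocks

/-! ### Representation by permutations, and the rank. -/

namespace NoncrossingTwoPartition

open Finset

variable {n : ℕ}

theorem eq_of_lam_subset {ψ φ : NoncrossingTwoPartition n} (h : ψ.π = φ.π)
    (hl : ∀ (B : {B // B ∈ ψ.π.parts}) (B' : {B // B ∈ φ.π.parts}), B.1 = B'.1 →
      (ψ.lam B).1 ⊆ (φ.lam B').1) : ψ = φ := by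
  have hl' : ∀ (B : {B // B ∈ ψ.π.parts}) (B' : {B // B ∈ φ.π.parts}), B.1 = B'.1 →
      (ψ.lam B).1 = (φ.lam B').1 := fun B B' hB => by
    apply eq_of_subset_of_card_le (hl B B' hB)
    rw [ψ.card_lam, φ.card_lam, hB]
  apply le_antisymm
  · rw [le_iff]
    refine ⟨h.ge, fun B B' hB => (hl' B' B ?_).ge⟩
    exact (eq_of_subset_parts (show B.1 ∈ ψ.π.parts by rw [h]; exact B.2) B'.2 hB).symm
  · rw [le_iff]
    refine ⟨h.le, fun B B' hB => (hl' B B' ?_).le⟩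
    exact eq_of_subset_parts B.2 (show B'.1 ∈ ψ.π.parts by rw [h]; exact B'.2) hB

/-- The noncrossing 2-partition with first component `P` and bijection `B ↦ σ(B)`. -/
def ofPerm (P : Finpartition (univ : Finset (Fin n))) (hP : IsNoncrossing P)
    (σ : Equiv.Perm (Fin n)) : NoncrossingTwoPartition n where
  π := P
  ρ := Finpartition.ofExistsUnique (P.parts.map σ.finsetCongr.toEmbedding)
    (fun _ _ => subset_univ _)
    (by
      intro x _
      obtain ⟨B, ⟨hB, hx⟩, hu⟩ := P.existsUnique_mem (mem_univ (σ.symm x))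
      refine ⟨σ.finsetCongr B, ⟨mem_map_of_mem _ hB, by simpa using hx⟩, ?_⟩
      rintro C ⟨hC, hxC⟩
      obtain ⟨D, hD, rfl⟩ := mem_map.1 hC
      exact congrArg _ (hu D ⟨hD, by simpa using hxC⟩))
    (by
      intro h
      obtain ⟨D, hD, h⟩ := mem_map.1 h
      have : D = ∅ := by simpa using h
      exact P.empty_notMem_parts (this ▸ hD))
  noncrossing := hP
  lam := σ.finsetCongr.subtypeEquiv fun B => (mem_map' _).symm
  card_lam := fun B => card_map _

theorem eq_ofPerm {ψ : NoncrossingTwoPartition n} {P : Finpartition (univ : Finset (Fin n))}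
    (hP : IsNoncrossing P) {σ : Equiv.Perm (Fin n)} (h : ψ.π = P)
    (hσ : ∀ (B : {B // B ∈ ψ.π.parts}), ∀ x ∈ B.1, σ x ∈ (ψ.lam B).1) : ψ = ofPerm P hP σ := by
  subst h
  refine (eq_of_lam_subset (ψ := ofPerm ψ.π hP σ) (φ := ψ) rfl fun B B' hB => ?_).symm
  obtain rfl : B = B' := Subtype.ext hB
  change B.1.map σ.toEmbedding ⊆ _
  intro y hy
  obtain ⟨x, hx, rfl⟩ := mem_map.1 hy
  exact hσ B x hx

/-- Bijections B → λ(B) exist because the sizes agree, and they glue to a permutation: B and λ(B)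
are the fibres of f and g over the same index. -/
theorem exists_eq_ofPerm (φ : NoncrossingTwoPartition n) :
    ∃ σ, φ = ofPerm φ.π φ.noncrossing σ := by
  let f : Fin n → {B // B ∈ φ.π.parts} := fun x => ⟨φ.π.part x, φ.π.part_mem.2 (mem_univ x)⟩
  let g : Fin n → {B // B ∈ φ.π.parts} :=
    fun x => φ.lam.symm ⟨φ.ρ.part x, φ.ρ.part_mem.2 (mem_univ x)⟩
  have hf (B) (x) : f x = B ↔ x ∈ B.1 := by
    rw [← φ.π.part_eq_iff_mem B.2, Subtype.ext_iff]
  have hg (B) (x) : g x = B ↔ x ∈ (φ.lam B).1 := by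
    rw [← φ.ρ.part_eq_iff_mem (φ.lam B).2, Equiv.symm_apply_eq, Subtype.ext_iff]
  have e (B) : Nonempty ({x // f x = B} ≃ {x // g x = B}) := by
    refine ⟨(Equiv.subtypeEquivRight (hf B)).trans (Equiv.trans ?_
      (Equiv.subtypeEquivRight (hg B)).symm)⟩
    exact (Finset.equivOfCardEq (φ.card_lam B)).symm
  refine ⟨Equiv.ofFiberEquiv (f := f) (g := g) fun B => (e B).some, eq_ofPerm _ rfl fun B x hx => ?_⟩
  rw [← hg, ← hf] at *
  exact (Equiv.ofFiberEquiv_map (fun B => (e B).some) x).trans hx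

theorem ofPerm_le_ofPerm {P Q : Finpartition (univ : Finset (Fin n))} (hP : IsNoncrossing P)
    (hQ : IsNoncrossing Q) (h : Q ≤ P) (σ : Equiv.Perm (Fin n)) :
    ofPerm P hP σ ≤ ofPerm Q hQ σ := by
  rw [le_iff]
  refine ⟨h, fun B B' hB => ?_⟩
  exact map_subset_map.2 hB

/-- Below a fixed element the first component determines everything: a larger block is sent to the
union of the images of its parts, which is again its image under σ. -/
theorem eq_ofPerm_of_le {ψ : NoncrossingTwoPartition n} {Q : Finpartition (univ : Finset (Fin n))}
    (hQ : IsNoncrossing Q) {σ : Equiv.Perm (Fin n)} (h : ψ ≤ ofPerm Q hQ σ) :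
    ψ = ofPerm ψ.π ψ.noncrossing σ := by
  rw [le_iff] at h
  refine eq_ofPerm _ rfl fun B' x hx => ?_
  obtain ⟨B, hB, hxB⟩ := Q.exists_mem (mem_univ x)
  obtain ⟨D, hD, hBD⟩ := h.1 hB
  obtain rfl := ψ.π.eq_of_mem_parts hD B'.2 (hBD hxB) hx
  exact h.2 ⟨B, hB⟩ B' hBD (mem_map_of_mem _ hxB)

theorem card_parts_lt_of_lt {ψ φ : NoncrossingTwoPartition n} (h : ψ < φ) :
    #ψ.π.parts < #φ.π.parts := by
  by_contra hcon
  have hπ : φ.π = ψ.π := eq_of_le_of_card_le h.le.1 (not_lt.1 hcon)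
  obtain ⟨σ, hσ⟩ := exists_eq_ofPerm φ
  have h1 := eq_ofPerm_of_le φ.noncrossing (hσ ▸ h.le)
  apply h.ne
  rw [h1, hσ]
  congr 1
  exact hπ.symm

theorem exists_lt_of_one_lt_card (φ : NoncrossingTwoPartition n) (h : 1 < #φ.π.parts) :
    ∃ ψ < φ, #ψ.π.parts + 1 = #φ.π.parts := by
  obtain ⟨A, hA, B, hB, hAB, a, ha, b, hb, hab⟩ := exists_adjacent_of_one_lt_card h
  obtain ⟨σ, hσ⟩ := exists_eq_ofPerm φ
  have hc := card_mergeBlocks hA hB hAB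
  have hnc := isNoncrossing_mergeBlocks φ.noncrossing hA hB ha hb hab
  refine ⟨ofPerm _ hnc σ, lt_of_le_of_ne ?_ ?_, hc⟩
  · conv_rhs => rw [hσ]
    exact ofPerm_le_ofPerm _ _ (le_mergeBlocks hA hB) σ
  · intro heq
    have : #(mergeBlocks φ.π hA hB).parts = #φ.π.parts :=
      congrArg (fun ψ : NoncrossingTwoPartition n => #ψ.π.parts) heq
    omega

/-- The rank of a noncrossing 2-partition is its number of blocks minus one. -/
theorem height_eq (φ : NoncrossingTwoPartition n) :
    Order.height φ = ((#φ.π.parts - 1 : ℕ) : ℕ∞) := by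
  induction hN : #φ.π.parts using Nat.strong_induction_on generalizing φ with
  | _ N ih =>
    apply le_antisymm
    · rw [Order.height_le_coe_iff]
      intro ψ hψ
      have hlt := card_parts_lt_of_lt hψ
      rw [ih _ (hN ▸ hlt) ψ rfl]
      have : 0 < #ψ.π.parts := by
        apply card_pos.2
        obtain ⟨B, hB⟩ := card_pos.1 (show 0 < #φ.π.parts by omega)
        obtain ⟨D, hD, -⟩ := hψ.le.1 hB
        exact ⟨D, hD⟩
      exact_mod_cast (show #ψ.π.parts - 1 < N - 1 by omega)
    · rcases Nat.lt_or_ge 1 N with h | h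
      · obtain ⟨ψ, hψ, hc⟩ := exists_lt_of_one_lt_card φ (hN ▸ h)
        have h1 := ih _ (show #ψ.π.parts < N by omega) ψ rfl
        have h2 := Order.height_add_one_le hψ
        rw [h1] at h2
        refine le_trans ?_ h2
        exact_mod_cast (show N - 1 ≤ #ψ.π.parts - 1 + 1 by omega)
      -- This also covers N = 0, which occurs for n = 0; the truncated difference is then 0.
      · rw [Nat.sub_eq_zero_of_le h]
        simp

end NoncrossingTwoPartition

/-! ### Weighted sums over chains of noncrossing partitions. -/

section ChainSums

open Finset PowerSeries

variable {n : ℕ} {R : Type*} [CommRing R]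

/-- The noncrossing partitions of `Fin n`, ordered by refinement. -/
abbrev NoncrossingPartition (n : ℕ) : Type :=
  {P : Finpartition (univ : Finset (Fin n)) // IsNoncrossing P}

noncomputable instance : Fintype (NoncrossingPartition n) := Fintype.ofFinite _

theorem isNoncrossingFamily_parts (P : NoncrossingPartition n) :
    IsNoncrossingFamily univ P.1.parts where
  nonempty _ hB := P.1.nonempty_of_mem_parts hB
  eq_of_mem _ hA _ hB _ hxA hxB := P.1.eq_of_mem_parts hA hB hxA hxB
  mem_iff x := ⟨fun hx => P.1.exists_mem hx, fun _ => mem_univ x⟩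
  uncrossed A hA B hB hAB i hi j hj k hk l hl hij hjk hkl :=
    P.2 A hA B hB hAB ⟨i, j, k, l, hij, hjk, hkl, hi, hk, hj, hl⟩

/-- The noncrossing partition with a given set of blocks. -/
def IsNoncrossingFamily.toPartition {F : Finset (Finset (Fin n))}
    (h : IsNoncrossingFamily univ F) : NoncrossingPartition n where
  val := Finpartition.ofExistsUnique F (fun _ _ => subset_univ _)
    (fun x hx => by
      obtain ⟨B, hB, hxB⟩ := (h.mem_iff x).1 hx
      exact ⟨B, ⟨hB, hxB⟩, fun C hC => h.eq_of_mem C hC.1 B hB x hC.2 hxB⟩)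
    (fun he => not_nonempty_empty (h.nonempty _ he))
  property := by
    rintro A hA B hB hAB ⟨i, j, k, l, hij, hjk, hkl, hi, hk, hj, hl⟩
    exact h.uncrossed A hA B hB hAB i hi j hj k hk l hl hij hjk hkl

theorem sum_noncrossingPartition (f : Finset (Finset (Fin n)) → R)
    (p : Finset (Finset (Fin n)) → Prop) [DecidablePred p] :
    ∑ P : NoncrossingPartition n with p P.1.parts, f P.1.parts =
      ∑ F ∈ ncFamilies univ with p F, f F := by
  refine sum_bij (fun P _ => P.1.parts) ?_ ?_ ?_ ?_
  · intro P hP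
    exact mem_filter.2
      ⟨mem_ncFamilies.2 (isNoncrossingFamily_parts P), (mem_filter.1 hP).2⟩
  · intro P _ Q _ h
    exact Subtype.ext (Finpartition.ext h)
  · intro F hF
    have hF := mem_filter.1 hF
    exact ⟨(mem_ncFamilies.1 hF.1).toPartition, mem_filter.2 ⟨mem_univ _, hF.2⟩, rfl⟩
  · intros; rfl

-- A noncrossing refinement of P is an independent choice of a noncrossing partition of each block
-- of P.
open Classical in
theorem sum_noncrossingPartition_le (w : ℕ → R) (P : NoncrossingPartition n) :
    ∑ Q : NoncrossingPartition n with Q ≤ P, ∏ B ∈ Q.1.parts, w #B =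
      ∏ B ∈ P.1.parts, ncSum w B := by
  have hP := isNoncrossingFamily_parts P
  have h := sum_refining_families w (fun B : {B // B ∈ P.1.parts} => B.1)
    (fun A B x hA hB => Subtype.ext (P.1.eq_of_mem_parts A.2 B.2 hA hB))
    (fun A B hAB => hP.uncrossed A A.2 B B.2 fun h => hAB (Subtype.ext h))
  have hu : (univ : Finset {B // B ∈ P.1.parts}).biUnion (fun B => B.1) = univ := by
    ext x
    simpa using P.1.exists_mem (mem_univ x)
  rw [hu, prod_coe_sort P.1.parts fun B => ncSum w B] at h
  have h' := sum_noncrossingPartition (fun F => ∏ B ∈ F, w #B)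
    (fun F => ∀ B ∈ F, ∃ A : {A // A ∈ P.1.parts}, B ⊆ A.1)
  refine Eq.trans (sum_congr (filter_congr fun Q _ => ?_) fun _ _ => rfl)
    (h'.trans (Eq.trans (sum_congr (by ext; simp only [mem_filter]) fun _ _ => rfl) h))
  constructor
  · intro hQ B hB
    obtain ⟨C, hC, hBC⟩ := hQ hB
    exact ⟨⟨C, hC⟩, hBC⟩
  · intro hQ B hB
    obtain ⟨C, hBC⟩ := hQ B hB
    exact ⟨C.1, C.2, hBC⟩

/-- The weight of a block size obtained by summing over noncrossing partitions of a block. -/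
noncomputable def refineWeight (w : ℕ → R) : ℕ → R := fun n => coeff n (ncSeries w)

theorem refineWeight_zero (w : ℕ → R) : refineWeight w 0 = 1 := by
  rw [refineWeight, ncSeries, coeff_mk, range_zero, ncSum_empty]

theorem mk_refineWeight (w : ℕ → R) : PowerSeries.mk (refineWeight w) = ncSeries w := by
  ext n; simp [refineWeight]

theorem sum_noncrossingPartition_univ (w : ℕ → R) :
    ∑ P : NoncrossingPartition n, ∏ B ∈ P.1.parts, w #B = refineWeight w n := by
  classical
  have h := sum_noncrossingPartition (n := n) (fun F => ∏ B ∈ F, w #B) (fun _ => True)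
  simp only [filter_true] at h
  rw [h, refineWeight]
  have := ncSum_eq_coeff w (univ : Finset (Fin n))
  rwa [card_univ, Fintype.card_fin] at this

theorem antitone_snoc_iff {β : Type*} [Preorder β] {k : ℕ} (p : Fin (k + 1) → β) (x : β) :
    Antitone (Fin.snoc p x : Fin (k + 2) → β) ↔ Antitone p ∧ x ≤ p (Fin.last k) := by
  rw [Fin.antitone_iff_succ_le, Fin.antitone_iff_succ_le, Fin.forall_fin_succ']
  apply and_congr
  · refine forall_congr' fun i => ?_
    rw [Fin.succ_castSucc, Fin.snoc_castSucc, Fin.snoc_castSucc]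
  · rw [Fin.succ_last, Fin.snoc_last, Fin.snoc_castSucc]

open Classical in
/-- Weighted sum over multichains of noncrossing partitions. -/
theorem sum_antitone_chains (w : ℕ → R) (k : ℕ) :
    ∑ p : Fin (k + 1) → NoncrossingPartition n with Antitone p,
      ∏ B ∈ (p (Fin.last k)).1.parts, w #B = refineWeight^[k + 1] w n := by
  induction k generalizing w with
  | zero =>
    have h1 (p : Fin (0 + 1) → NoncrossingPartition n) : Antitone p := fun i j _ => by
      rw [Subsingleton.elim (α := Fin 1) i j]
    rw [filter_true_of_mem fun p _ => h1 p, Function.iterate_one,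
      ← sum_noncrossingPartition_univ]
    exact Fintype.sum_equiv (Equiv.funUnique (Fin 1) _) _ _ fun _ => rfl
  | succ k ih =>
    -- The innermost application of `refineWeight` sums out the last, finest partition of the chain.
    rw [Function.iterate_succ_apply, ← ih]
    have h1 (p : Fin (k + 1) → NoncrossingPartition n) :
        ∏ B ∈ (p (Fin.last k)).1.parts, refineWeight w #B =
        ∑ Q : NoncrossingPartition n with Q ≤ p (Fin.last k), ∏ B ∈ Q.1.parts, w #B := by
      rw [sum_noncrossingPartition_le]
      exact prod_congr rfl fun B _ => (ncSum_eq_coeff w B).symm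
    simp only [h1, sum_filter]
    rw [← (Fin.snocEquiv fun _ => NoncrossingPartition n).sum_comp, Fintype.sum_prod_type_right]
    refine sum_congr rfl fun p _ => ?_
    by_cases hp : Antitone p
    · rw [if_pos hp]
      refine sum_congr rfl fun Q _ => ?_
      simp [Fin.snocEquiv, antitone_snoc_iff, hp]
    · rw [if_neg hp]
      refine sum_eq_zero fun Q _ => ?_
      simp [Fin.snocEquiv, antitone_snoc_iff, hp]

theorem mk_iterate_refineWeight (w : ℕ → R) (hw : w 0 = 1) (k : ℕ) :
    PowerSeries.mk (refineWeight^[k] w) =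
      (PowerSeries.mk w).subst (X * PowerSeries.mk (refineWeight^[k] w) ^ k) := by
  have h0 : ∀ j, (refineWeight^[j] w) 0 = 1 := by
    intro j
    cases j with
    | zero => exact hw
    | succ j => rw [Function.iterate_succ_apply', refineWeight_zero]
  refine eq_subst_of_forall_eq_subst (M := fun j => PowerSeries.mk (refineWeight^[j] w))
    (fun j => ?_) k
  simp only [Function.iterate_succ_apply', mk_refineWeight]
  exact ncSeries_eq_subst _ (h0 j)

/-- The weight `t / s!` of a block with `s` elements. -/
noncomputable def labelWeight (s : ℕ) : Polynomial ℚ :=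
  coeff s (1 + C Polynomial.X * (exp (Polynomial ℚ) - 1))

theorem labelWeight_zero : labelWeight 0 = 1 := by simp [labelWeight]

theorem labelWeight_of_ne_zero {s : ℕ} (hs : s ≠ 0) :
    labelWeight s = Polynomial.X * Polynomial.C (1 / (s.factorial : ℚ)) := by
  rw [labelWeight, map_add, coeff_C_mul, map_sub, coeff_exp, coeff_one, if_neg hs]
  simp

theorem coeff_iterate_labelWeight (n k ℓ : ℕ) :
    n.factorial * (refineWeight^[k] labelWeight n).coeff (ℓ + 1) =
      (ℓ.factorial * (k * n).choose ℓ * n.stirlingSecond (ℓ + 1) : ℕ) := by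
  have h := coeff_of_eq_subst (c := PowerSeries.mk labelWeight)
    (by rw [← coeff_zero_eq_constantCoeff_apply, coeff_mk, labelWeight_zero]) k
    (mk_iterate_refineWeight labelWeight labelWeight_zero k) n
  have hmk : PowerSeries.mk labelWeight = 1 + C Polynomial.X * (exp (Polynomial ℚ) - 1) := by
    ext1 s; rw [coeff_mk]; rfl
  have h2 := congrArg (fun q => Polynomial.coeff q (ℓ + 1)) h
  rw [hmk, coeff_coeff_one_add_C_X_mul_exp_sub_one_pow, coeff_mk, ← Polynomial.C_eq_natCast,
    Polynomial.coeff_C_mul, eq_div_iff (by positivity)] at h2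
  -- This absorption identity cancels the factor kn + 1 of Lagrange inversion and turns (ℓ + 1)!
  -- into ℓ!.
  have h3 : ((k * n + 1 : ℕ) : ℚ) * (k * n).choose ℓ = (k * n + 1).choose (ℓ + 1) * (ℓ + 1 : ℕ) := by
    exact_mod_cast Nat.add_one_mul_choose_eq (k * n) ℓ
  have h4 : ((k * n + 1 : ℕ) : ℚ) ≠ 0 := by positivity
  apply mul_left_cancel₀ h4
  push_cast [Nat.factorial_succ] at h2 h3 ⊢
  linear_combination h2 - (ℓ.factorial : ℚ) * (n.stirlingSecond (ℓ + 1) : ℚ) * h3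

/-- Blocks are nonempty, so each contributes exactly one factor t and the exponent of t is the
number of blocks. -/
theorem coeff_prod_labelWeight (P : Finpartition (univ : Finset (Fin n))) (j : ℕ) :
    (∏ B ∈ P.parts, labelWeight #B).coeff j =
      if #P.parts = j then ∏ B ∈ P.parts, (1 / ((#B).factorial : ℚ)) else 0 := by
  rw [prod_congr rfl fun B hB =>
    labelWeight_of_ne_zero (card_pos.2 (P.nonempty_of_mem_parts hB)).ne', prod_mul_distrib,
    prod_const, ← map_prod, mul_comm, Polynomial.coeff_C_mul_X_pow]
  simp only [eq_comm]

end ChainSums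

/-! ### Counting the elements over a given noncrossing partition. -/

namespace NoncrossingTwoPartition

open Finset

variable {n : ℕ}

/-- σ and τ have the same image on every block exactly when τ⁻¹σ preserves every block. -/
theorem ofPerm_eq_ofPerm_iff {P : Finpartition (univ : Finset (Fin n))} (hP : IsNoncrossing P)
    (σ τ : Equiv.Perm (Fin n)) :
    ofPerm P hP τ = ofPerm P hP σ ↔ P.part ∘ (τ⁻¹ * σ : Equiv.Perm (Fin n)) = P.part := by
  have hmem (x) (B : Finset (Fin n)) : σ x ∈ B.map τ.toEmbedding ↔ (τ⁻¹ * σ) x ∈ B := by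
    rw [mem_map_equiv]; rfl
  constructor
  · intro h
    funext x
    have hx := P.part_mem.2 (mem_univ x)
    have key : ∀ (ψ : NoncrossingTwoPartition n) (B : {B // B ∈ ψ.π.parts}),
        ψ = ofPerm P hP σ → (ψ.lam B).1 = B.1.map σ.toEmbedding := by
      rintro _ B rfl
      rfl
    have h1 : (P.part x).map τ.toEmbedding = (P.part x).map σ.toEmbedding :=
      key _ ⟨P.part x, hx⟩ h
    refine P.part_eq_of_mem hx ((hmem _ _).1 ?_)
    rw [h1]
    exact mem_map_of_mem _ (P.mem_part_self.2 (mem_univ x))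
  · intro h
    refine eq_ofPerm hP rfl fun B x hx => (hmem _ _).2 ?_
    have h1 := congrFun h x
    rwa [Function.comp_apply, P.part_eq_of_mem B.2 hx, P.part_eq_iff_mem B.2] at h1

/-- The number of noncrossing 2-partitions with a given first component. -/
theorem card_mul_prod_factorial (P : NoncrossingPartition n) :
    Nat.card {φ : NoncrossingTwoPartition n // φ.π = P.1} * ∏ B ∈ P.1.parts, (#B).factorial =
      n.factorial := by
  classical
  let f : Fin n → {B // B ∈ P.1.parts} := fun x => ⟨P.1.part x, P.1.part_mem.2 (mem_univ x)⟩
  have hf (g : Equiv.Perm (Fin n)) : f ∘ g = f ↔ P.1.part ∘ g = P.1.part := by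
    simp only [funext_iff, Function.comp_apply, f, Subtype.mk.injEq]
  let F : Equiv.Perm (Fin n) → {φ : NoncrossingTwoPartition n // φ.π = P.1} :=
    fun σ => ⟨ofPerm P.1 P.2 σ, rfl⟩
  have : Fintype {φ : NoncrossingTwoPartition n // φ.π = P.1} := Fintype.ofFinite _
  have hfib (φ) : Fintype.card {σ // F σ = φ} = ∏ B ∈ P.1.parts, (#B).factorial := by
    obtain ⟨φ, hφ⟩ := φ
    obtain ⟨τ, hτ⟩ := exists_eq_ofPerm φ
    have hτ' : φ = ofPerm P.1 P.2 τ := by rw [hτ]; congr 1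
    -- Each fibre is a coset of the stabilizer of the block map f, which has ∏|B|! elements.
    have e : {σ // F σ = ⟨φ, hφ⟩} ≃ {g : Equiv.Perm (Fin n) // f ∘ g = f} :=
      (Equiv.mulLeft τ⁻¹).subtypeEquiv fun σ => by
        rw [hf, Equiv.coe_mulLeft, ← ofPerm_eq_ofPerm_iff P.2, Subtype.ext_iff, ← hτ', eq_comm]
    rw [Fintype.card_congr e, DomMulAct.stabilizer_card f,
      ← prod_coe_sort P.1.parts fun B => (#B).factorial]
    refine prod_congr rfl fun B _ => ?_
    congr 1
    rw [Fintype.card_subtype]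
    congr 1
    ext x
    simp only [mem_filter, mem_univ, true_and, f, Subtype.ext_iff]
    exact P.1.part_eq_iff_mem B.2
  have h1 := Fintype.card_congr (Equiv.sigmaFiberEquiv F)
  rw [Fintype.card_sigma, Finset.sum_congr rfl fun φ _ => hfib φ, Finset.sum_const, card_univ,
    smul_eq_mul, Fintype.card_perm, Fintype.card_fin] at h1
  rw [Nat.card_eq_fintype_card, h1]

end NoncrossingTwoPartition

/-! ### Reduction of multichains to chains of noncrossing partitions, and the final count. -/

namespace NoncrossingTwoPartition

open Finset

variable {n : ℕ}

/-- Multichains with prescribed first components correspond to their top elements. -/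
theorem card_multichains_over {k : ℕ} {p : Fin (k + 1) → NoncrossingPartition n}
    (hp : Antitone p) :
    Nat.card {φ : Fin (k + 1) → NoncrossingTwoPartition n //
      Monotone φ ∧ ∀ i, (φ i).π = (p i).1} =
    Nat.card {φ : NoncrossingTwoPartition n // φ.π = (p (Fin.last k)).1} := by
  refine Nat.card_congr (Equiv.ofBijective (fun φ => ⟨φ.1 (Fin.last k), φ.2.2 _⟩) ⟨?_, ?_⟩)
  · rintro ⟨φ, hφ, hφp⟩ ⟨ψ, hψ, hψp⟩ h
    have h : φ (Fin.last k) = ψ (Fin.last k) := congrArg Subtype.val h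
    obtain ⟨σ, hσ⟩ := exists_eq_ofPerm (φ (Fin.last k))
    apply Subtype.ext
    funext i
    have h1 := eq_ofPerm_of_le _ ((hφ (Fin.le_last i)).trans hσ.le)
    have h2 := eq_ofPerm_of_le _ ((hψ (Fin.le_last i)).trans (h ▸ hσ.le))
    have h3 : (φ i).π = (ψ i).π := (hφp i).trans (hψp i).symm
    change φ i = ψ i
    rw [h1, h2]
    congr 1
  · rintro ⟨φ, hφ⟩
    obtain ⟨σ, hσ⟩ := exists_eq_ofPerm φ
    -- One permutation representing the top element lifts the whole chain.
    refine ⟨⟨fun i => ofPerm (p i).1 (p i).2 σ, fun i j hij =>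
      ofPerm_le_ofPerm _ _ (hp hij) σ, fun i => rfl⟩, Subtype.ext ?_⟩
    change ofPerm _ _ σ = φ
    rw [hσ]
    congr 1
    exact hφ.symm

theorem card_multichains_eq_sum (k ℓ : ℕ) (hn : 1 ≤ n) [DecidablePred
    fun p : Fin (k + 1) → NoncrossingPartition n => Antitone p] :
    Nat.card {φ : Fin (k + 1) → NoncrossingTwoPartition n //
      Monotone φ ∧ Order.height (φ (Fin.last k)) = (ℓ : ℕ∞)} =
    ∑ p : Fin (k + 1) → NoncrossingPartition n with Antitone p,
      if #(p (Fin.last k)).1.parts = ℓ + 1 then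
        Nat.card {φ : NoncrossingTwoPartition n // φ.π = (p (Fin.last k)).1} else 0 := by
  classical
  have : Fintype (NoncrossingTwoPartition n) := Fintype.ofFinite _
  have hheight (φ : NoncrossingTwoPartition n) :
      Order.height φ = (ℓ : ℕ∞) ↔ #φ.π.parts = ℓ + 1 := by
    -- Since n ≥ 1 there is a block, so the truncated difference in `height_eq` can be inverted to ℓ
    -- + 1 blocks.
    have : φ.π.parts.Nonempty := by
      obtain ⟨B, hB, -⟩ := φ.π.exists_mem (mem_univ (⟨0, hn⟩ : Fin n))
      exact ⟨B, hB⟩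
    have := card_pos.2 this
    rw [height_eq, Nat.cast_inj]
    omega
  simp only [hheight]
  rw [Nat.card_eq_fintype_card, Fintype.card_subtype,
    card_eq_sum_card_fiberwise (f := fun φ i => (⟨(φ i).π, (φ i).noncrossing⟩ :
      NoncrossingPartition n))
      (t := univ.filter fun p : Fin (k + 1) → NoncrossingPartition n => Antitone p)]
  · refine sum_congr rfl fun p hp => ?_
    have hp := (mem_filter.1 hp).2
    rw [filter_filter]
    split_ifs with hc
    · rw [← card_multichains_over hp, Nat.card_eq_fintype_card, Fintype.card_subtype]
      congr 1
      refine filter_congr fun φ _ => ?_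
      simp only [funext_iff, Subtype.ext_iff]
      constructor
      · exact fun h => ⟨h.1.1, h.2⟩
      · exact fun h => ⟨⟨h.1, by rw [h.2]; exact hc⟩, h.2⟩
    · rw [card_eq_zero, filter_eq_empty_iff]
      rintro φ - ⟨⟨-, h⟩, rfl⟩
      exact hc h
  · intro φ hφ
    have hφ := (mem_filter.1 hφ).2
    exact mem_filter.2 ⟨mem_univ _, fun i j hij => (hφ.1 hij).1⟩

end NoncrossingTwoPartition

/-- For `n, k ≥ 1`, the number of multichains `φ₁ ≤ ⋯ ≤ φ_k` of noncrossing 2-partitions whose top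
element has rank `ℓ` in the poset (the maximal length of a strict chain ending there) is
`ℓ! * (kn choose ℓ) * S₂(n, ℓ + 1)`. -/
theorem mainTheorem2 (n k ℓ : ℕ) (hn : 1 ≤ n) (hk : 1 ≤ k) :
    Nat.card {φ : Fin k → NoncrossingTwoPartition n //
        Monotone φ ∧ Order.height (φ ⟨k - 1, by omega⟩) = (ℓ : ℕ∞)} =
      Nat.factorial ℓ * Nat.choose (k * n) ℓ * Nat.stirlingSecond n (ℓ + 1) := by
  classical
  obtain ⟨k, rfl⟩ := Nat.exists_eq_add_of_le' hk
  have h := NoncrossingTwoPartition.card_multichains_eq_sum (n := n) k ℓ hn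
  refine h.trans (Nat.cast_injective (R := ℚ) ?_)
  rw [← coeff_iterate_labelWeight, ← sum_antitone_chains, Polynomial.finsetSum_coeff,
    Finset.mul_sum, Nat.cast_sum]
  refine Finset.sum_congr rfl fun p _ => ?_
  rw [coeff_prod_labelWeight]
  split_ifs
  -- Writing n! as the number of elements over the finest partition times ∏|B|! cancels the weights
  -- 1/|B|!.
  · rw [← NoncrossingTwoPartition.card_mul_prod_factorial (p (Fin.last k))]
    push_cast
    rw [mul_assoc, ← Finset.prod_mul_distrib, Finset.prod_congr rfl fun B _ =>
      mul_one_div_cancel (Nat.cast_ne_zero.2 (Nat.factorial_ne_zero B.card)), Finset.prod_const_one,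
      mul_one]
  · simp
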